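/- Consider finitely many sources, links and paths. Each path $P$ is a set of links and belongs to one source; source $i$ has a nonempty set $\mathcal P_i$ of paths and a constant total rate $r_i\ge 0$. A flow allocation is a vector $r=(r_P)$ with $r_P\ge 0$ and $\sum_{P\in\mathcal P_i}r_P=r_i$ for all $i$; its link rates are $Ar$, where $A_{lP}=1$ if $l\in P$ and $A_{lP}=0$ otherwise. A link $l$ that carries rate $\rho\ge 0$ has delay $f_l(\rho)$. If $l$ is a valid link, $f_l$ is nonnegative, continuous and strictly increasing on $[0,\infty)$. If $l$ is an out-of-band wormhole, $f_l(\rho)=\alpha_l/(1-\Phi_l(\rho))$, where $\alpha_l>0$ is the propagation delay of the tunnel and the fraction $\Phi_l(\rho)\in[0,1)$ of dropped packets is continuous and strictly increasing in $\rho\ge 0$. Packet leashes drop a packet on link $l$ with probability $$P_{d,l}(\rho)=\begin{cases}\Pr(\Delta_l>\Delta_{\max,l}(\rho)), & l\text{ valid},\\ \Pr\big(\Delta_l>\tfrac1c(R_l-R_{1,l}-R_{2,l})-\alpha_l+\Delta_{\max,l}(\rho)\big), & l\text{ wormhole},\end{cases}$$ where $\Delta_l$ is a real random variable (the clock skew),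 $c>0$ is the speed of light, $R_l,R_{1,l},R_{2,l}$ are real constants (distances) and the extended real threshold $\Delta_{\max,l}(\rho)$ is nonincreasing in $\rho$; $P_{d,l}$ is assumed continuous and less than $1$ on $[0,\infty)$. The leash adds the delay $g_l(\rho)=\big(\frac1{1-P_{d,l}(\rho)}-1\big)f_l(\rho)$. The path delays of $r$ are $q_P(r)=\sum_{l\in P}\big(f_l+g_l\big)((Ar)_l)$. A Wardrop equilibrium is a flow allocation such that $r_P>0$ implies $q_P\le q_{P'}$ for all paths $P'$ of the same source. Let $r^*$ be a Wardrop equilibrium, $q^*=q(r^*)$, $z^*=Ar^*$, and let $\{x\}_+^{\rho}=0$ if $x>0$ and $\rho=0$, and $\{x\}_+^{\rho}=x$ otherwise. Consider the systems - $(\tilde H_1)$, with state $r$ and input $u$: with $q=q^*-u$ and $P_i^{\min}\in\arg\min_{P\in\mathcal P_i}q_P$, put $\dot r_P=-\{q_P-q_{P_i^{\min}}\}_+^{r_P}$ for $P\in\mathcal P_i$, $P\ne P_i^{\min}$, and $\dot r_{P_i^{\min}}=-\sum_{P\in\mathcal P_i,P\neq P_i^{\min}}\dot r_P$; output $y^{(1)}=\dot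 r$; - $(\tilde H_2)$: $\dot z=u^{(2)}$, output $y^{(2)}_l=f_l(z_l)-f_l(z_l^*)$; - $(\tilde H_3)$: $\dot w=u^{(3)}$, output $y^{(3)}_l=g_l(w_l)-g_l(z_l^*)$; in the negative feedback interconnection $u^{(2)}=u^{(3)}=Ay^{(1)}$, $u=-A^T(y^{(2)}+y^{(3)})$. If minimal paths are not unique, the velocity $\dot r$ may be any convex combination of the velocities given by the possible choices of the $P_i^{\min}$. The feasible states are $(r,Ar,Ar)$ with $r$ a flow allocation. A trajectory is a locally absolutely continuous curve of states $(r(t),z(t),w(t))$, $t\ge 0$, which starts at a feasible state, has $r_P(t)\ge 0$ for all $P$ and $t$, and satisfies the equations for almost every $t\geq 0$. A nonempty set $E$ is called globally asymptotically stable if a trajectory starts at every feasible state, $E$ is Lyapunov stable, and the distance of every trajectory to $E$ tends to $0$ as $t\to\infty$. Then a Wardrop equilibrium exists, all Wardrop equilibria have the same link rates, and for every choice of the Wardrop equilibrium $r^*$: 1. the equilibria of the interconnection are exactly the states $(r,Ar,Ar)$ with $r$ a Wardrop equilibrium, and the set of them is globally asymptotically stable; 2. for the link-rate components $(z,w)$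 of the state, the unique equilibrium point $(z^*,z^*)$ is globally asymptotically stable (in the sense above, applied to the components $(z(t),w(t))$ of the trajectories); 3. if link rates and source rates determine path rates (i.e. $Ad=0$ and $\sum_{P\in\mathcal P_i}d_P=0$ for all $i$ imply $d=0$), then $(r^*,Ar^*,Ar^*)$ is the only equilibrium of the interconnection and is globally asymptotically stable. -/

import Mathlib

open Set Filter Topology MeasureTheory
open scoped Classical

noncomputable section

/-! ### Input/output systems and stability -/

/-- A state-space system with state space `X`, input space `U` and output space `Y`:
`(v, y) ∈ rel x u` means that in state `x`, under input `u`, the state may move with velocity `v`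
while the output is `y`.  (Several velocities are possible where the right-hand side of the
dynamics involves the choice of a minimizing index.) -/
structure IOSystem (X U Y : Type*) where
  rel : X → U → Set (X × Y)

/-- The forward trajectories of the differential inclusion `x' ∈ F x` with initial state in `D`
whose states stay in the physical region `S`: locally absolutely continuous curves that satisfy
the inclusion at almost every time `t ≥ 0`. -/
structure IsTrajectory {X : Type*} [NormedAddCommGroup X] [NormedSpace ℝ X]
    (F : X → Set X) (D S : Set X) (x : ℝ → X) : Prop where
  init : x 0 ∈ D
  mem : ∀ t, 0 ≤ t → x t ∈ S
  ac : ∀ T, 0 ≤ T → AbsolutelyContinuousOnInterval x 0 T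
  deriv : ∀ᵐ t ∂(volume.restrict (Ici (0 : ℝ))), ∃ v ∈ F (x t), HasDerivAt x v t

/-- Global asymptotic stability of the set `E` for the family `𝒯` of trajectories with initial
states in `D`: trajectories exist from every initial state for all time, `E` is Lyapunov stable,
and every trajectory converges to `E`.  For `E = {e}` this is global asymptotic stability of the
point `e`. -/
structure IsGAS {X : Type*} [PseudoMetricSpace X] (𝒯 : Set (ℝ → X)) (D E : Set X) : Prop where
  nonempty : E.Nonempty
  exists_trajectory : ∀ x₀ ∈ D, ∃ x ∈ 𝒯, x 0 = x₀
  stable : ∀ ε > 0, ∃ δ > 0, ∀ x ∈ 𝒯, Metric.infDist (x 0) E < δ →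
    ∀ t, 0 ≤ t → Metric.infDist (x t) E < ε
  attractive : ∀ x ∈ 𝒯, Tendsto (fun t => Metric.infDist (x t) E) atTop (𝓝 0)

/-! ### The network, the out-of-band wormhole and the packet leash -/

/-- The data of a network with out-of-band wormhole links and packet leashes. -/
structure OutOfBandNetwork (Source Path Link : Type*) where
  /-- the source that uses a path -/
  source : Path → Source
  /-- the links of a path -/
  links : Path → Finset Link
  /-- the constant total rate of a source -/
  rate : Source → ℝ
  /-- the wormhole links; all others are valid links -/
  wormhole : Set Link
  /-- the delay of a valid link as a function of the rate through it -/
  validDelay : Link → ℝ → ℝ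
  /-- the propagation delay of a wormhole tunnel -/
  tunnelDelay : Link → ℝ
  /-- the fraction of packets dropped by a wormhole, as a function of the rate through it -/
  dropFraction : Link → ℝ → ℝ
  /-- the speed of light -/
  c : ℝ
  /-- the propagation distance for which the leash of a link is computed -/
  dist : Link → ℝ
  /-- the distance of the sender from the wormhole entrance -/
  distIn : Link → ℝ
  /-- the distance of the receiver from the wormhole exit -/
  distOut : Link → ℝ
  /-- the law of the random clock skew between the end nodes of a link -/
  skew : Link → ProbabilityMeasure ℝ
  /-- the maximum permissible clock skew, tuned by the network to the rate through the link
  (`⊤` means that no leash is imposed) -/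
  maxSkew : Link → ℝ → EReal

namespace OutOfBandNetwork

variable {Source Path Link : Type*} [Fintype Path] [Fintype Link]
  (N : OutOfBandNetwork Source Path Link)

/-- The delay `f_l(ρ)` of link `l` at rate `ρ` before mitigation. -/
def linkDelay (l : Link) (ρ : ℝ) : ℝ :=
  if l ∈ N.wormhole then N.tunnelDelay l / (1 - N.dropFraction l ρ) else N.validDelay l ρ

/-- A packet is dropped by the leash on link `l` when the clock skew exceeds this threshold. -/
def skewThreshold (l : Link) (ρ : ℝ) : EReal :=
  if l ∈ N.wormhole then
    (((1 / N.c) * (N.dist l - N.distIn l - N.distOut l) - N.tunnelDelay l : ℝ) : EReal)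
      + N.maxSkew l ρ
  else N.maxSkew l ρ

/-- The probability `P_d` that a packet is dropped by the leash on link `l` at rate `ρ`. -/
def leashDropProb (l : Link) (ρ : ℝ) : ℝ :=
  (N.skew l : Measure ℝ).real {δ : ℝ | N.skewThreshold l ρ < (δ : EReal)}

/-- The additional delay on link `l` at rate `ρ` caused by the packet leash. -/
def leashDelay (l : Link) (ρ : ℝ) : ℝ :=
  (1 / (1 - N.leashDropProb l ρ) - 1) * N.linkDelay l ρ

/-- The standing assumptions.  Rates are nonnegative, so all functions of a rate matter on
`[0, ∞)` only. -/
structure Assumptions : Prop where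
  exists_path : ∀ i, ∃ P, N.source P = i
  rate_nonneg : ∀ i, 0 ≤ N.rate i
  validDelay_nonneg : ∀ l ∉ N.wormhole, ∀ ρ, 0 ≤ ρ → 0 ≤ N.validDelay l ρ
  validDelay_strictMono : ∀ l ∉ N.wormhole, StrictMonoOn (N.validDelay l) (Ici 0)
  validDelay_continuous : ∀ l ∉ N.wormhole, ContinuousOn (N.validDelay l) (Ici 0)
  tunnelDelay_pos : ∀ l ∈ N.wormhole, 0 < N.tunnelDelay l
  dropFraction_nonneg : ∀ l ∈ N.wormhole, ∀ ρ, 0 ≤ ρ → 0 ≤ N.dropFraction l ρ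
  dropFraction_lt_one : ∀ l ∈ N.wormhole, ∀ ρ, 0 ≤ ρ → N.dropFraction l ρ < 1
  dropFraction_strictMono : ∀ l ∈ N.wormhole, StrictMonoOn (N.dropFraction l) (Ici 0)
  dropFraction_continuous : ∀ l ∈ N.wormhole, ContinuousOn (N.dropFraction l) (Ici 0)
  c_pos : 0 < N.c
  maxSkew_antitone : ∀ l, AntitoneOn (N.maxSkew l) (Ici 0)
  leashDropProb_lt_one : ∀ l, ∀ ρ, 0 ≤ ρ → N.leashDropProb l ρ < 1
  leashDropProb_continuous : ∀ l, ContinuousOn (N.leashDropProb l) (Ici 0)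

/-- The matrix `A` with `A l P = 1` if link `l` is in path `P`, and `0` otherwise. -/
def incidence : Matrix Link Path ℝ := fun l P => if l ∈ N.links P then 1 else 0

/-- The vector of link rates `A r` of a vector `r` of path rates. -/
def linkRate (r : Path → ℝ) : Link → ℝ := N.incidence.mulVec r

/-- The flow allocations that meet the source rates. -/
def IsFeasible (r : Path → ℝ) : Prop :=
  (∀ P, 0 ≤ r P) ∧ ∀ i, ∑ P with N.source P = i, r P = N.rate i

/-- The total delay of each path: the delays of its links plus the delays added by mitigation. -/
def pathDelay (r : Path → ℝ) (P : Path) : ℝ :=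
  ∑ l ∈ N.links P, (N.linkDelay l (N.linkRate r l) + N.leashDelay l (N.linkRate r l))

/-- Wardrop equilibria: feasible allocations in which every path in use has minimal delay among
the paths of its source. -/
def IsWardrop (r : Path → ℝ) : Prop :=
  N.IsFeasible r ∧ ∀ P, 0 < r P → ∀ P', N.source P' = N.source P →
    N.pathDelay r P ≤ N.pathDelay r P'

/-! ### Flow allocation dynamics -/

/-- `{x}_+^ρ`. -/
def gatedPart (x ρ : ℝ) : ℝ := if 0 < x ∧ ρ = 0 then 0 else x

/-- `m i` is a path of minimal delay of source `i`, for every `i`, given the path delays `q`. -/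
def IsMinPath (q : Path → ℝ) (m : Source → Path) : Prop :=
  ∀ i, N.source (m i) = i ∧ ∀ P, N.source P = i → q (m i) ≤ q P

/-- The rate of change of the flow allocation `r` when the path delays are `q` and `m i` is the
minimal path selected by source `i`. -/
def flowVelocity (q : Path → ℝ) (m : Source → Path) (r : Path → ℝ) (P : Path) : ℝ :=
  if P = m (N.source P) then
    -∑ P' with N.source P' = N.source P ∧ P' ≠ P, -gatedPart (q P' - q P) (r P')
  else -gatedPart (q P - q (m (N.source P))) (r P)

/-- The flow allocation system `H̃₁`, with path delays `q* - u` where `q*` are the path delays at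
the equilibrium `rs`.  If a source has several minimal paths, the right-hand side is
discontinuous, and solutions are understood in the sense of Filippov: the velocity is any convex
combination of the velocities that belong to the possible selections of the minimal paths (so it
is the velocity itself where these are unique). -/
def H₁ (rs : Path → ℝ) : IOSystem (Path → ℝ) (Path → ℝ) (Path → ℝ) where
  rel r u := {vy | vy.1 ∈ convexHull ℝ {v | ∃ m, N.IsMinPath (N.pathDelay rs - u) m ∧
      v = N.flowVelocity (N.pathDelay rs - u) m r} ∧ vy.2 = vy.1}

/-- The link delay system `H̃₂`. -/
def H₂ (rs : Path → ℝ) : IOSystem (Link → ℝ) (Link → ℝ) (Link → ℝ) where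
  rel z u := {vy | vy.1 = u ∧
    vy.2 = fun l => N.linkDelay l (z l) - N.linkDelay l (N.linkRate rs l)}

/-- The mitigation system `H̃₃`. -/
def H₃ (rs : Path → ℝ) : IOSystem (Link → ℝ) (Link → ℝ) (Link → ℝ) where
  rel w u := {vy | vy.1 = u ∧
    vy.2 = fun l => N.leashDelay l (w l) - N.leashDelay l (N.linkRate rs l)}

/-- States of the interconnection: the states of `H̃₁`, `H̃₂` and `H̃₃`. -/
abbrev State (Path Link : Type*) : Type _ := (Path → ℝ) × (Link → ℝ) × (Link → ℝ)

/-- The negative feedback interconnection: `H̃₂` and `H̃₃` both have the input `A y₁`, and `H̃₁`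
has the input `-Aᵀ (y₂ + y₃)`.  The value is the set of possible velocities of the joint state. -/
def interconnection (rs : Path → ℝ) (x : State Path Link) : Set (State Path Link) :=
  {v | ∃ (y₁ : Path → ℝ) (y₂ y₃ : Link → ℝ),
    (v.1, y₁) ∈ (N.H₁ rs).rel x.1 (-(N.incidence.transpose.mulVec (y₂ + y₃))) ∧
    (v.2.1, y₂) ∈ (N.H₂ rs).rel x.2.1 (N.incidence.mulVec y₁) ∧
    (v.2.2, y₃) ∈ (N.H₃ rs).rel x.2.2 (N.incidence.mulVec y₁)}

/-- The joint state that belongs to a flow allocation: `H̃₂` and `H̃₃` carry the link rates. -/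
def stateOf (r : Path → ℝ) : State Path Link := (r, N.linkRate r, N.linkRate r)

/-- The feasible joint states. -/
def feasibleStates : Set (State Path Link) := N.stateOf '' {r | N.IsFeasible r}

/-- The trajectories of the interconnection that start at feasible states; flow rates are
nonnegative at all times. -/
def trajectories (rs : Path → ℝ) : Set (ℝ → State Path Link) :=
  {x | IsTrajectory (N.interconnection rs) N.feasibleStates {s | ∀ P, 0 ≤ s.1 P} x}

/-- The equilibria of the interconnection. -/
def equilibria (rs : Path → ℝ) : Set (State Path Link) :=
  {x | x ∈ N.feasibleStates ∧ 0 ∈ N.interconnection rs x}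

/-- The link rates and the source rates determine the path rates. -/
def LinkRatesDeterminePathRates : Prop :=
  ∀ d : Path → ℝ, (∀ i, ∑ P with N.source P = i, d P = 0) → N.linkRate d = 0 → d = 0

end OutOfBandNetwork

end

/-! From a feasible state, `z - Ar`, `w - Ar` and the source totals are conserved. Hence `z = w =
Ar`, the feedback reproduces the true path delays, and the interconnection reduces to a differential
inclusion for `r` in the compact polytope of flow allocations.

The total delay of a link is `f / (1 - P_d)`, continuous and strictly increasing. So the Beckmann
potential `V`, the sum over links of the primitives of the total delays, is convex in the link
rates. Its minimizers over flow allocations are exactly the Wardrop equilibria, and strict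
monotonicity forces these to share their link rates.

Let `e_P` be the excess of a path delay over the minimum of its source. The convexified velocities
are described by `IsVelocity`, which yields `dV/dt = -∑ e_P²` over the paths in use
(`IsVelocity.sum_mul_eq`). Convexity gives `V - V* ≤ ∑ e_P r_P`, and Cauchy–Schwarz turns this into
`dV/dt ≤ -(V - V*)² / C` (`potential_sub_sq_le`). Therefore `V` decreases to `V*` with no invariance
principle, and compactness converts this into stability and attraction (`isGAS_of_lyapunov`).

The right-hand side is discontinuous, so trajectories are built as limits of an implicit Euler
scheme whose steps are minimization problems (`exists_implicit_step`, `exists_flow`). -/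

/-! ### Absolutely continuous curves -/

namespace AbsolutelyContinuousOnInterval

theorem comp_lipschitzOnWith {X Y : Type*} [PseudoMetricSpace X] [PseudoMetricSpace Y]
    {f : ℝ → X} {g : X → Y} {s : Set X} {K : NNReal} {a b : ℝ}
    (hg : LipschitzOnWith K g s) (hf : AbsolutelyContinuousOnInterval f a b)
    (hs : ∀ t ∈ uIcc a b, f t ∈ s) : AbsolutelyContinuousOnInterval (fun t => g (f t)) a b := by
  unfold AbsolutelyContinuousOnInterval at hf ⊢
  have hlim := hf.const_mul (K : ℝ)
  rw [mul_zero] at hlim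
  refine squeeze_zero' (Eventually.of_forall fun _ => Finset.sum_nonneg fun _ _ => dist_nonneg)
    ?_ hlim
  rw [eventually_inf_principal]
  filter_upwards with E hE
  rw [Finset.mul_sum]
  refine Finset.sum_le_sum fun i hi => ?_
  exact hg.dist_le_mul _ (hs _ (hE.1 i hi).1) _ (hs _ (hE.1 i hi).2)

/-- An absolutely continuous curve is bounded on the interval, and a `C¹` function is Lipschitz on a
compact interval containing its values. -/
theorem comp_contDiff {f : ℝ → ℝ} {g : ℝ → ℝ} {a b : ℝ} (hg : ContDiff ℝ 1 g)
    (hf : AbsolutelyContinuousOnInterval f a b) :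
    AbsolutelyContinuousOnInterval (fun t => g (f t)) a b := by
  obtain ⟨C, hC⟩ := hf.exists_bound
  obtain ⟨K, hK⟩ := (hg.contDiffOn (s := Icc (-C) C)).exists_lipschitzOnWith (by decide)
    (convex_Icc _ _) isCompact_Icc
  exact comp_lipschitzOnWith hK hf fun t ht => abs_le.1 (hC t ht)

theorem comp_clm {E F : Type*} [NormedAddCommGroup E] [NormedSpace ℝ E] [NormedAddCommGroup F]
    [NormedSpace ℝ F] {f : ℝ → E} {a b : ℝ} (g : E →L[ℝ] F)
    (hf : AbsolutelyContinuousOnInterval f a b) :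
    AbsolutelyContinuousOnInterval (fun t => g (f t)) a b :=
  comp_lipschitzOnWith (g.lipschitz.lipschitzOnWith (s := univ)) hf fun _ _ => mem_univ _

theorem finset_sum {ι : Type*} (s : Finset ι) {f : ι → ℝ → ℝ} {a b : ℝ}
    (hf : ∀ i ∈ s, AbsolutelyContinuousOnInterval (f i) a b) :
    AbsolutelyContinuousOnInterval (fun t => ∑ i ∈ s, f i t) a b := by
  induction s using Finset.induction_on with
  | empty =>
    simpa using ((LipschitzWith.const (0 : ℝ)).lipschitzOnWith
      (s := uIcc a b)).absolutelyContinuousOnInterval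
  | insert i s hi ih =>
    simp only [Finset.sum_insert hi]
    exact (hf i (Finset.mem_insert_self i s)).fun_add
      (ih fun j hj => hf j (Finset.mem_insert_of_mem hj))

end AbsolutelyContinuousOnInterval

/-- The source of the conservation laws along trajectories. -/
theorem eq_of_ae_hasDerivAt_zero {F : Type*} [NormedAddCommGroup F] [NormedSpace ℝ F]
    {f : ℝ → F} (hf : ∀ T, 0 ≤ T → AbsolutelyContinuousOnInterval f 0 T)
    (h : ∀ᵐ t ∂(volume.restrict (Ici (0 : ℝ))), HasDerivAt f 0 t) {t : ℝ} (ht : 0 ≤ t) :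
    f t = f 0 := by
  rw [ae_restrict_iff' measurableSet_Ici] at h
  obtain ⟨C, hC⟩ := (hf t ht).const_of_ae_hasDerivAt_zero (by
    filter_upwards [h] with s hs hs'
    rw [uIcc_of_le ht] at hs'
    exact hs hs'.1)
  rw [hC t right_mem_uIcc, hC 0 left_mem_uIcc]

theorem sub_le_mul_of_ae_deriv_le {φ : ℝ → ℝ} {a b c : ℝ} (hab : a ≤ b)
    (hφ : AbsolutelyContinuousOnInterval φ a b)
    (h : ∀ᵐ t, t ∈ Icc a b → deriv φ t ≤ c) : φ b - φ a ≤ c * (b - a) := by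
  rw [← hφ.integral_deriv_eq_sub]
  calc ∫ x in a..b, deriv φ x ≤ ∫ _ in a..b, c := by
        refine intervalIntegral.integral_mono_ae_restrict hab hφ.intervalIntegrable_deriv
          intervalIntegrable_const ?_
        rw [EventuallyLE, ae_restrict_iff' measurableSet_Icc]
        exact h
    _ = c * (b - a) := by rw [intervalIntegral.integral_const, smul_eq_mul, mul_comm]

/-- While `φ` stays above `m + η` it falls at rate at least `η² / C`, which its lower bound `m`
permits only for a bounded time; monotonicity keeps it below `m + η` afterwards. -/
theorem antitoneOn_and_tendsto_of_deriv_le_neg_sq {φ : ℝ → ℝ} {m C : ℝ} (hC : 0 < C)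
    (hφ : ∀ T, 0 ≤ T → AbsolutelyContinuousOnInterval φ 0 T) (hm : ∀ t, 0 ≤ t → m ≤ φ t)
    (h : ∀ᵐ t ∂(volume.restrict (Ici (0 : ℝ))), deriv φ t ≤ -((φ t - m) ^ 2 / C)) :
    AntitoneOn φ (Ici 0) ∧ Tendsto φ atTop (𝓝 m) := by
  rw [ae_restrict_iff' measurableSet_Ici] at h
  have hanti : AntitoneOn φ (Ici 0) := by
    intro a ha b hb hab
    have hac : AbsolutelyContinuousOnInterval φ a b := by
      refine (hφ b hb).mono ?_
      rw [uIcc_of_le hab, uIcc_of_le (mem_Ici.1 hb)]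
      exact Icc_subset_Icc_left ha
    have := sub_le_mul_of_ae_deriv_le (c := 0) hab hac (by
      filter_upwards [h] with t ht ht'
      exact (ht (le_trans (mem_Ici.1 ha) ht'.1)).trans (by
        rw [Left.neg_nonpos_iff]; positivity))
    linarith
  refine ⟨hanti, ?_⟩
  rw [Metric.tendsto_atTop]
  intro η hη
  obtain ⟨T, hT0, hT⟩ : ∃ T, 0 ≤ T ∧ φ T < m + η := by
    by_contra! hcon
    have hpos : 0 < η ^ 2 / C := by positivity
    -- By this time a fall at rate `η² / C` would bring `φ` down to `m - 1`.
    set T := (φ 0 - m + 1) / (η ^ 2 / C) with hTdef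
    have hT : 0 ≤ T := div_nonneg (by linarith [hm 0 le_rfl]) hpos.le
    have := sub_le_mul_of_ae_deriv_le (c := -(η ^ 2 / C)) hT (hφ T hT) (by
      filter_upwards [h] with t ht ht'
      refine (ht ht'.1).trans (neg_le_neg ?_)
      have := hcon t ht'.1
      gcongr
      linarith)
    have hmul : η ^ 2 / C * T = φ 0 - m + 1 := by
      rw [hTdef]; field_simp
    have := hm T hT
    nlinarith
  refine ⟨T, fun t ht => ?_⟩
  have h1 := hanti (mem_Ici.2 hT0) (mem_Ici.2 (hT0.trans ht)) ht
  have h2 := hm t (hT0.trans ht)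
  rw [Real.dist_eq, abs_of_nonneg (by linarith)]
  linarith

/-! ### Lyapunov functions on compact sets -/

/-- On the compact set `K`, closeness of `V` to its minimum `m` and closeness to `E` control each
other uniformly (`near` and `far`), so monotonicity and convergence of `V` transfer to the distance.
-/
theorem isGAS_of_lyapunov {X : Type*} [MetricSpace X] {𝒯 : Set (ℝ → X)} {D K E : Set X}
    {V : X → ℝ} {m : ℝ} (hK : IsCompact K) (hV : ContinuousOn V K) (hEK : E ⊆ K)
    (hne : E.Nonempty) (hE : ∀ x ∈ E, V x = m) (hlt : ∀ x ∈ K, x ∉ E → m < V x)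
    (hex : ∀ x₀ ∈ D, ∃ x ∈ 𝒯, x 0 = x₀) (hmem : ∀ x ∈ 𝒯, ∀ t, 0 ≤ t → x t ∈ K)
    (hanti : ∀ x ∈ 𝒯, AntitoneOn (fun t => V (x t)) (Ici 0))
    (hlim : ∀ x ∈ 𝒯, Tendsto (fun t => V (x t)) atTop (𝓝 m)) : IsGAS 𝒯 D E := by
  have hdist : Continuous fun x => Metric.infDist x E := Metric.continuous_infDist_pt E
  have hEcl : IsClosed E := by
    have : E = K ∩ V ⁻¹' Iic m := by
      ext x
      refine ⟨fun hx => ⟨hEK hx, (hE x hx).le⟩, fun hx => ?_⟩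
      by_contra hxE
      exact absurd (hlt x hx.1 hxE) (not_lt.2 hx.2)
    rw [this]
    exact hV.preimage_isClosed_of_isClosed hK.isClosed isClosed_Iic
  have near : ∀ ε > 0, ∃ η > 0, ∀ x ∈ K, V x < m + η → Metric.infDist x E < ε := by
    intro ε hε
    have hK' : IsCompact (K ∩ {x | ε ≤ Metric.infDist x E}) :=
      hK.inter_right (isClosed_le continuous_const hdist)
    rcases (K ∩ {x | ε ≤ Metric.infDist x E}).eq_empty_or_nonempty with h0 | h0
    · refine ⟨1, one_pos, fun x hx _ => ?_⟩
      by_contra! hcon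
      exact (h0 ▸ (⟨hx, hcon⟩ : x ∈ K ∩ {x | ε ≤ Metric.infDist x E}) : x ∈ (∅ : Set X))
    · obtain ⟨y, hy, hmin⟩ := hK'.exists_isMinOn h0 (hV.mono inter_subset_left)
      have hyE : y ∉ E := fun h => by
        have h2 := hy.2
        simp only [mem_ofPred_eq, Metric.infDist_zero_of_mem h] at h2
        linarith
      refine ⟨V y - m, sub_pos.2 (hlt y hy.1 hyE), fun x hx hVx => ?_⟩
      by_contra! hcon
      have := hmin (⟨hx, hcon⟩ : x ∈ K ∩ {x | ε ≤ Metric.infDist x E})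
      simp only [mem_ofPred_eq] at this
      linarith
  -- Since `E` is closed, the distance to `E` has a positive minimum on the compact part of `K`
  -- where `V ≥ m + η`.
  have far : ∀ η > 0, ∃ δ > 0, ∀ x ∈ K, Metric.infDist x E < δ → V x < m + η := by
    intro η hη
    have hcl : IsClosed (K ∩ V ⁻¹' Ici (m + η)) :=
      hV.preimage_isClosed_of_isClosed hK.isClosed isClosed_Ici
    have hK' : IsCompact (K ∩ V ⁻¹' Ici (m + η)) := hK.of_isClosed_subset hcl inter_subset_left
    rcases (K ∩ V ⁻¹' Ici (m + η)).eq_empty_or_nonempty with h0 | h0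
    · refine ⟨1, one_pos, fun x hx _ => ?_⟩
      by_contra! hcon
      exact (h0 ▸ (⟨hx, hcon⟩ : x ∈ K ∩ V ⁻¹' Ici (m + η)) : x ∈ (∅ : Set X))
    · obtain ⟨y, hy, hmin⟩ := hK'.exists_isMinOn h0 hdist.continuousOn
      have hyE : y ∉ E := fun h => by
        have h2 : m + η ≤ V y := hy.2
        have := hE y h
        linarith
      refine ⟨Metric.infDist y E, (hEcl.notMem_iff_infDist_pos hne).1 hyE, fun x hx hd => ?_⟩
      by_contra! hcon
      have := hmin (⟨hx, hcon⟩ : x ∈ K ∩ V ⁻¹' Ici (m + η))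
      simp only [mem_ofPred_eq] at this
      linarith
  refine ⟨hne, hex, fun ε hε => ?_, fun x hx => ?_⟩
  · obtain ⟨η, hη, h1⟩ := near ε hε
    obtain ⟨δ, hδ, h2⟩ := far η hη
    refine ⟨δ, hδ, fun x hx hd t ht => h1 _ (hmem x hx t ht) ?_⟩
    exact (hanti x hx self_mem_Ici (mem_Ici.2 ht) ht).trans_lt (h2 _ (hmem x hx 0 le_rfl) hd)
  · rw [Metric.tendsto_atTop]
    intro ε hε
    obtain ⟨η, hη, h1⟩ := near ε hε
    obtain ⟨T, hT⟩ := eventually_atTop.1 ((hlim x hx).eventually_lt_const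
      (show m < m + η by linarith))
    refine ⟨max T 0, fun t ht => ?_⟩
    rw [Real.dist_eq, sub_zero, abs_of_nonneg Metric.infDist_nonneg]
    exact h1 _ (hmem x hx t ((le_max_right _ _).trans ht)) (hT t ((le_max_left _ _).trans ht))

/-! ### Limits of Euler schemes -/

/-- A compactness theorem for schemes with time step `1 / (n + 1)`. Linear one-sided bounds on the
increments survive in the limit as bounds on the derivative. They are only required when the
endpoint of a step is near `x t`, which suits an implicit scheme. -/
theorem exists_limit_of_discrete_curves {E : Type*} [NormedAddCommGroup E] [NormedSpace ℝ E]
    {K : Set E} (hK : IsCompact K) {B : ℝ} (hB : 0 ≤ B) {x₀ : E} (ρ : ℕ → ℕ → E)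
    (h0 : ∀ n, ρ n 0 = x₀) (hmem : ∀ n k, ρ n k ∈ K)
    (hstep : ∀ n k, dist (ρ n (k + 1)) (ρ n k) ≤ B / (n + 1)) :
    ∃ x : ℝ → E, LipschitzWith B.toNNReal x ∧ x 0 = x₀ ∧ (∀ t, x t ∈ K) ∧
      ∀ t v, 0 ≤ t → HasDerivAt x v t → ∀ (f : E →L[ℝ] ℝ) (c δ : ℝ), 0 < δ →
        (∀ n k, dist (ρ n (k + 1)) (x t) < δ → f (ρ n (k + 1) - ρ n k) ≤ c / (n + 1)) →
        f v ≤ c := by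
  have hsteps : ∀ n a b, a ≤ b → dist (ρ n b) (ρ n a) ≤ B / (n + 1) * ((b : ℝ) - a) := by
    intro n a b hab
    induction b, hab using Nat.le_induction with
    | base => simp
    | succ b hab ih =>
      calc dist (ρ n (b + 1)) (ρ n a) ≤ dist (ρ n (b + 1)) (ρ n b) + dist (ρ n b) (ρ n a) :=
            dist_triangle _ _ _
        _ ≤ B / (n + 1) + B / (n + 1) * ((b : ℝ) - a) := add_le_add (hstep n b) ih
        _ = _ := by push_cast; ring
  let j : ℕ → ℝ → ℕ := fun n t => ⌊t * (n + 1)⌋₊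
  have hj_mono : ∀ n, Monotone (j n) := fun n a b hab =>
    Nat.floor_le_floor (mul_le_mul_of_nonneg_right hab (by positivity))
  have hj_sub : ∀ n s t, 0 ≤ s → s ≤ t → |((j n t : ℝ) - j n s) / (n + 1) - (t - s)| ≤
      1 / ((n : ℝ) + 1) := by
    intro n s t hs hst
    have hn : (0 : ℝ) < n + 1 := by positivity
    have h1 := Nat.floor_le (mul_nonneg hs hn.le)
    have h2 := Nat.floor_le (mul_nonneg (hs.trans hst) hn.le)
    have h3 := Nat.lt_floor_add_one (s * ((n : ℝ) + 1))
    have h4 := Nat.lt_floor_add_one (t * ((n : ℝ) + 1))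
    have : ((j n t : ℝ) - j n s) / (n + 1) - (t - s) =
        ((j n t : ℝ) - j n s - (t - s) * (n + 1)) / (n + 1) := by field_simp
    rw [this, abs_div, abs_of_pos hn]
    gcongr
    rw [abs_le]
    constructor <;> simp only [j] <;> nlinarith
  -- A single free ultrafilter gives limits at all times simultaneously, so no subsequence has to be
  -- extracted.
  let U : Ultrafilter ℕ := hyperfilter ℕ
  have hU : (U : Filter ℕ) ≤ atTop := by
    rw [← Nat.cofinite_eq_atTop]; exact hyperfilter_le_cofinite
  have hlim : ∀ t, ∃ y ∈ K, Tendsto (fun n => ρ n (j n t)) U (𝓝 y) := by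
    intro t
    obtain ⟨y, hy, hle⟩ := hK.ultrafilter_le_nhds' (U.map fun n => ρ n (j n t))
      (Ultrafilter.mem_map.2 (univ_mem' fun n => hmem n _))
    exact ⟨y, hy, hle⟩
  choose x hxK hx using hlim
  have hsmall : Tendsto (fun n : ℕ => 1 / ((n : ℝ) + 1)) U (𝓝 0) :=
    tendsto_one_div_add_atTop_nhds_zero_nat.mono_left hU
  have hjlim : ∀ s t, 0 ≤ s → s ≤ t →
      Tendsto (fun n => ((j n t : ℝ) - j n s) / (n + 1)) U (𝓝 (t - s)) := by
    intro s t hs hst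
    rw [tendsto_iff_dist_tendsto_zero]
    exact squeeze_zero (fun _ => dist_nonneg) (fun n => hj_sub n s t hs hst) hsmall
  -- The natural-number floor of a negative number is `0`, so the limit curve is constant before
  -- time `0`; this makes it Lipschitz on the whole line.
  have hneg : ∀ t, t ≤ 0 → x t = x 0 := by
    intro t ht
    refine tendsto_nhds_unique (hx t) ?_
    have hj0 : ∀ n, j n t = j n 0 := fun n => by
      simp only [j, zero_mul, Nat.floor_zero]
      exact Nat.floor_of_nonpos (mul_nonpos_of_nonpos_of_nonneg ht (by positivity))
    simpa only [hj0] using hx 0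
  have hlip0 : ∀ s t, 0 ≤ s → s ≤ t → dist (x t) (x s) ≤ B * (t - s) := by
    intro s t hs hst
    refine le_of_tendsto_of_tendsto ((hx t).dist (hx s)) ((hjlim s t hs hst).const_mul B) ?_
    refine Eventually.of_forall fun n => ?_
    refine (hsteps n _ _ (hj_mono n hst)).trans_eq ?_
    ring
  have hlip : ∀ s t, s ≤ t → dist (x t) (x s) ≤ B * (t - s) := by
    intro s t hst
    rcases le_total 0 s with hs | hs
    · exact hlip0 s t hs hst
    rcases le_total 0 t with ht | ht
    · rw [hneg s hs]
      exact (hlip0 0 t le_rfl ht).trans (mul_le_mul_of_nonneg_left (by linarith) hB)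
    · rw [hneg s hs, hneg t ht, dist_self]
      exact mul_nonneg hB (by linarith)
  refine ⟨x, LipschitzWith.of_dist_le_mul fun t s => ?_, ?_, hxK, ?_⟩
  · rw [Real.coe_toNNReal B hB]
    rcases le_total s t with h | h
    · rw [Real.dist_eq, abs_of_nonneg (sub_nonneg.2 h)]; exact hlip s t h
    · rw [dist_comm, dist_comm t, Real.dist_eq, abs_of_nonneg (sub_nonneg.2 h)]; exact hlip t s h
  · refine tendsto_nhds_unique (hx 0) ?_
    simp [j, h0]
  · intro t v ht hv f c δ hδ hf
    have key : ∀ s, t < s → B * (s - t) < δ → f (x s) - f (x t) ≤ c * (s - t) := by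
      intro s hts hs
      refine le_of_tendsto_of_tendsto (((f.continuous.tendsto _).comp (hx s)).sub
        ((f.continuous.tendsto _).comp (hx t))) ((hjlim t s ht hts.le).const_mul c) ?_
      -- The left side bounds the distance to `x t` of every iterate between times `t` and `s`, so
      -- the increment bound applies to each of these steps and can be summed.
      have h1 : Tendsto (fun n => B * (((j n s : ℝ) - j n t) / (n + 1)) +
          dist (ρ n (j n t)) (x t)) U (𝓝 (B * (s - t) + dist (x t) (x t))) :=
        ((hjlim t s ht hts.le).const_mul B).add ((hx t).dist tendsto_const_nhds)
      rw [dist_self, add_zero] at h1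
      filter_upwards [h1.eventually_lt_const hs] with n hn
      have hclose : ∀ k, j n t ≤ k → k ≤ j n s → dist (ρ n k) (x t) < δ := by
        intro k hk1 hk2
        refine lt_of_le_of_lt (dist_triangle _ (ρ n (j n t)) _) (lt_of_le_of_lt ?_ hn)
        gcongr
        refine (hsteps n _ _ hk1).trans ?_
        have : (k : ℝ) ≤ j n s := by exact_mod_cast hk2
        rw [div_mul_eq_mul_div, mul_div_assoc]
        gcongr
      have hsum : ∀ k, j n t ≤ k → k ≤ j n s →
          f (ρ n k) - f (ρ n (j n t)) ≤ c / (n + 1) * ((k : ℝ) - j n t) := by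
        intro k hk
        induction k, hk using Nat.le_induction with
        | base => simp
        | succ k hk ih =>
          intro hk2
          have h2 := ih (by omega)
          have h3 := hf n k (hclose (k + 1) (by omega) hk2)
          rw [map_sub] at h3
          push_cast
          linarith
      refine (hsum _ (hj_mono n hts.le) le_rfl).trans_eq ?_
      ring
    have hder : HasDerivAt (fun s => f (x s)) (f v) t := f.hasFDerivAt.comp_hasDerivAt t hv
    have hslope := (hasDerivAt_iff_tendsto_slope.1 hder).mono_left
      (nhdsWithin_mono t (s := Ioi t) fun s hs => ne_of_gt hs)
    refine le_of_tendsto hslope ?_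
    have hnear : ∀ᶠ s in 𝓝[>] t, B * (s - t) < δ := by
      have : Tendsto (fun s => B * (s - t)) (𝓝[>] t) (𝓝 (B * (t - t))) :=
        (Continuous.tendsto (by fun_prop) t).mono_left nhdsWithin_le_nhds
      exact this.eventually_lt_const (by simpa using hδ)
    filter_upwards [hnear, self_mem_nhdsWithin] with s hs hts
    rw [slope_def_field, div_le_iff₀ (sub_pos.2 hts)]
    exact key s hts hs

set_option linter.unusedSectionVars false

noncomputable section

namespace OutOfBandNetwork

variable {Source Path Link : Type*} [Fintype Path] [Fintype Link]
  (N : OutOfBandNetwork Source Path Link)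

/-! ### Delay functions -/

section Delay

variable {N}

theorem linkDelay_nonneg (hN : N.Assumptions) (l : Link) {ρ : ℝ} (hρ : 0 ≤ ρ) :
    0 ≤ N.linkDelay l ρ := by
  unfold linkDelay
  split_ifs with h
  · exact div_nonneg (hN.tunnelDelay_pos l h).le
      (sub_nonneg.2 (hN.dropFraction_lt_one l h ρ hρ).le)
  · exact hN.validDelay_nonneg l h ρ hρ

theorem linkDelay_strictMonoOn (hN : N.Assumptions) (l : Link) :
    StrictMonoOn (N.linkDelay l) (Ici 0) := by
  intro a ha b hb hab
  unfold linkDelay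
  split_ifs with h
  · have h1 := hN.dropFraction_strictMono l h ha hb hab
    have h2 := hN.dropFraction_lt_one l h b hb
    exact div_lt_div_of_pos_left (hN.tunnelDelay_pos l h) (by linarith) (by linarith)
  · exact hN.validDelay_strictMono l h ha hb hab

theorem linkDelay_continuousOn (hN : N.Assumptions) (l : Link) :
    ContinuousOn (N.linkDelay l) (Ici 0) := by
  by_cases h : l ∈ N.wormhole
  · have : N.linkDelay l = fun ρ => N.tunnelDelay l / (1 - N.dropFraction l ρ) := by
      ext ρ; simp [linkDelay, h]
    rw [this]
    refine continuousOn_const.div (continuousOn_const.sub (hN.dropFraction_continuous l h)) ?_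
    intro ρ hρ
    have := hN.dropFraction_lt_one l h ρ hρ
    linarith
  · have : N.linkDelay l = N.validDelay l := by
      ext ρ; simp [linkDelay, h]
    rw [this]
    exact hN.validDelay_continuous l h

/-- A larger rate lowers the threshold and so enlarges the drop event; the constant shift for
wormholes is harmless. -/
theorem leashDropProb_monotoneOn (hN : N.Assumptions) (l : Link) :
    MonotoneOn (N.leashDropProb l) (Ici 0) := by
  intro a ha b hb hab
  have hthr : N.skewThreshold l b ≤ N.skewThreshold l a := by
    have := hN.maxSkew_antitone l ha hb hab
    unfold skewThreshold
    split_ifs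
    · exact add_le_add le_rfl this
    · exact this
  exact measureReal_mono fun δ hδ => hthr.trans_lt hδ

variable (N) in
/-- The total delay of a link, with the rate truncated to the physical range `[0, ∞)`. -/
def totalDelay (l : Link) (ρ : ℝ) : ℝ :=
  N.linkDelay l (max ρ 0) + N.leashDelay l (max ρ 0)

theorem totalDelay_eq_div (l : Link) (ρ : ℝ) :
    N.totalDelay l ρ = N.linkDelay l (max ρ 0) * (1 / (1 - N.leashDropProb l (max ρ 0))) := by
  unfold totalDelay leashDelay
  ring

theorem totalDelay_of_nonneg (l : Link) {ρ : ℝ} (hρ : 0 ≤ ρ) :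
    N.totalDelay l ρ = N.linkDelay l ρ + N.leashDelay l ρ := by
  rw [totalDelay, max_eq_left hρ]

/-- The total delay is the product of the strictly increasing, nonnegative `linkDelay` and the
positive, nondecreasing factor `1 / (1 - P_d)`. -/
theorem totalDelay_strictMonoOn (hN : N.Assumptions) (l : Link) :
    StrictMonoOn (N.totalDelay l) (Ici 0) := by
  intro a ha b hb hab
  rw [totalDelay_eq_div, totalDelay_eq_div, max_eq_left (mem_Ici.1 ha), max_eq_left (mem_Ici.1 hb)]
  have h1 := linkDelay_strictMonoOn hN l ha hb hab
  have h2 := leashDropProb_monotoneOn hN l ha hb hab.le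
  have h3 := hN.leashDropProb_lt_one l b hb
  have h4 := hN.leashDropProb_lt_one l a ha
  refine mul_lt_mul h1 (one_div_le_one_div_of_le (by linarith) (by linarith))
    (one_div_pos.2 (by linarith)) (linkDelay_nonneg hN l hb)

theorem totalDelay_monotone (hN : N.Assumptions) (l : Link) : Monotone (N.totalDelay l) := by
  intro a b hab
  have := (totalDelay_strictMonoOn hN l).monotoneOn (mem_Ici.2 (le_max_right a 0))
    (mem_Ici.2 (le_max_right b 0)) (max_le_max_right 0 hab)
  simpa [totalDelay] using this

theorem continuous_totalDelay (hN : N.Assumptions) (l : Link) : Continuous (N.totalDelay l) := by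
  have hmax : Continuous fun ρ : ℝ => max ρ 0 := continuous_id.max continuous_const
  have hmem : ∀ ρ : ℝ, max ρ 0 ∈ Ici (0 : ℝ) := fun ρ => le_max_right ρ 0
  have h1 := (linkDelay_continuousOn hN l).comp_continuous hmax hmem
  have h2 := (hN.leashDropProb_continuous l).comp_continuous hmax hmem
  have : N.totalDelay l = _ := funext fun ρ => totalDelay_eq_div l ρ
  rw [this]
  refine h1.mul (continuous_const.div (continuous_const.sub h2) fun ρ => ?_)
  have := hN.leashDropProb_lt_one l _ (hmem ρ)
  linarith

end Delay

/-! ### Link rates and path delays -/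

theorem linkRate_apply (r : Path → ℝ) (l : Link) :
    N.linkRate r l = ∑ P, if l ∈ N.links P then r P else 0 := by
  simp [linkRate, incidence, Matrix.mulVec, dotProduct]

theorem linkRate_nonneg {r : Path → ℝ} (hr : ∀ P, 0 ≤ r P) (l : Link) : 0 ≤ N.linkRate r l := by
  rw [linkRate_apply]
  exact Finset.sum_nonneg fun P _ => by split_ifs <;> simp [hr P]

/-- The link rates as a continuous linear function of the path rates. -/
def linkRateCLM : (Path → ℝ) →L[ℝ] (Link → ℝ) :=
  LinearMap.toContinuousLinearMap N.incidence.mulVecLin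

theorem linkRateCLM_apply (r : Path → ℝ) : N.linkRateCLM r = N.linkRate r := rfl

theorem continuous_linkRate : Continuous N.linkRate := N.linkRateCLM.continuous

/-- The delays of the paths when the links carry the rates `z`. -/
def delayAt (z : Link → ℝ) (P : Path) : ℝ := ∑ l ∈ N.links P, N.totalDelay l (z l)

theorem pathDelay_eq_delayAt {r : Path → ℝ} (hr : ∀ P, 0 ≤ r P) :
    N.pathDelay r = N.delayAt (N.linkRate r) := by
  ext P
  exact Finset.sum_congr rfl fun l _ => (totalDelay_of_nonneg l (N.linkRate_nonneg hr l)).symm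

/-- The adjoint relation between `A` and its transpose, which trades sums over links for sums over
paths. -/
theorem sum_mul_linkRate (h : Link → ℝ) (d : Path → ℝ) :
    ∑ l, h l * N.linkRate d l = ∑ P, (∑ l ∈ N.links P, h l) * d P := by
  simp_rw [linkRate_apply, Finset.mul_sum, Finset.sum_mul]
  rw [Finset.sum_comm]
  refine Finset.sum_congr rfl fun P _ => ?_
  simp

theorem continuous_delayAt {N : OutOfBandNetwork Source Path Link} (hN : N.Assumptions) :
    Continuous N.delayAt :=
  continuous_pi fun _ => continuous_finsetSum _ fun l _ =>
    (continuous_totalDelay hN l).comp (continuous_apply l)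

/-! ### Flow allocations -/

theorem isClosed_isFeasible : IsClosed {r | N.IsFeasible r} := by
  have : {r | N.IsFeasible r} = (⋂ P, {r : Path → ℝ | 0 ≤ r P}) ∩
      ⋂ i, {r | ∑ P with N.source P = i, r P = N.rate i} := by
    ext r; simp [IsFeasible]
  rw [this]
  exact (isClosed_iInter fun P => isClosed_le continuous_const (continuous_apply P)).inter
    (isClosed_iInter fun i => isClosed_eq
      (continuous_finsetSum _ fun P _ => continuous_apply P) continuous_const)

variable {N}

theorem IsFeasible.le_rate {r : Path → ℝ} (hr : N.IsFeasible r) (P : Path) :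
    r P ≤ N.rate (N.source P) := by
  rw [← hr.2 (N.source P)]
  exact Finset.single_le_sum (f := r) (fun P _ => hr.1 P) (by simp)

variable (N) in
theorem isCompact_isFeasible : IsCompact {r | N.IsFeasible r} :=
  (isCompact_univ_pi fun P =>
    isCompact_Icc (a := (0 : ℝ)) (b := N.rate (N.source P))).of_isClosed_subset
    N.isClosed_isFeasible fun _ hr P _ => ⟨hr.1 P, hr.le_rate P⟩

theorem exists_isFeasible (hN : N.Assumptions) : ∃ r, N.IsFeasible r := by
  choose m hm using hN.exists_path
  refine ⟨fun P => if P = m (N.source P) then N.rate (N.source P) else 0, fun P => ?_, fun i => ?_⟩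
  · dsimp only
    split_ifs
    · exact hN.rate_nonneg _
    · exact le_rfl
  · rw [Finset.sum_eq_single_of_mem (m i) (by simp [hm])]
    · simp [hm]
    · intro P hP hne
      rw [Finset.mem_filter] at hP
      rw [if_neg]
      rw [hP.2]
      exact hne

theorem IsFeasible.shift {r : Path → ℝ} (hr : N.IsFeasible r) {P P' : Path}
    (h : N.source P' = N.source P) {s : ℝ} (hs : 0 ≤ s) (hsP : s ≤ r P) :
    N.IsFeasible (r + s • (Pi.single P' 1 - Pi.single P 1)) := by
  refine ⟨fun R => ?_, fun i => ?_⟩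
  · have := hr.1 R
    simp only [Pi.add_apply, Pi.smul_apply, Pi.sub_apply, Pi.single_apply, smul_eq_mul]
    split_ifs with h1 h2 h2
    · linarith
    · linarith
    · subst h2; linarith
    · linarith
  · simp only [Pi.add_apply, Pi.smul_apply, Pi.sub_apply, Finset.sum_add_distrib, hr.2,
      ← Finset.smul_sum, Finset.sum_sub_distrib, Pi.single_apply, Finset.sum_ite_eq',
      Finset.mem_filter, Finset.mem_univ, true_and, h]
    simp

theorem sum_comp_source_mul (c : Source → ℝ) {d : Path → ℝ}
    (hd : ∀ i, ∑ P with N.source P = i, d P = 0) : ∑ P, c (N.source P) * d P = 0 := by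
  rw [← Finset.sum_fiberwise_of_maps_to (t := Finset.univ.image N.source)
    (g := N.source) fun P _ => Finset.mem_image_of_mem _ (Finset.mem_univ P)]
  refine Finset.sum_eq_zero fun i _ => ?_
  calc ∑ P with N.source P = i, c (N.source P) * d P
      = ∑ P with N.source P = i, c i * d P :=
        Finset.sum_congr rfl fun P hP => by rw [(Finset.mem_filter.1 hP).2]
    _ = 0 := by rw [← Finset.mul_sum, hd, mul_zero]

/-! ### Convex potentials -/

theorem hasDerivAt_primitive {h : ℝ → ℝ} (hh : Continuous h) (a : ℝ) :
    HasDerivAt (fun x => ∫ y in (0 : ℝ)..x, h y) (h a) a :=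
  intervalIntegral.integral_hasDerivAt_right (hh.intervalIntegrable _ _)
    (hh.stronglyMeasurableAtFilter _ _) hh.continuousAt

theorem contDiff_primitive {h : ℝ → ℝ} (hh : Continuous h) :
    ContDiff ℝ 1 (fun x => ∫ y in (0 : ℝ)..x, h y) := by
  rw [contDiff_one_iff_deriv]
  refine ⟨fun x => (hasDerivAt_primitive hh x).differentiableAt, ?_⟩
  have : deriv (fun x => ∫ y in (0 : ℝ)..x, h y) = h :=
    funext fun x => (hasDerivAt_primitive hh x).deriv
  rwa [this]

/-- The tangent inequality for the convex primitive of a monotone function. -/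
theorem mul_sub_le_primitive_sub {h : ℝ → ℝ} (hh : Continuous h) (hm : Monotone h) (a b : ℝ) :
    h a * (b - a) ≤ (∫ y in (0 : ℝ)..b, h y) - ∫ y in (0 : ℝ)..a, h y := by
  rw [intervalIntegral.integral_interval_sub_left (hh.intervalIntegrable _ _)
    (hh.intervalIntegrable _ _)]
  rcases le_total a b with hab | hab
  · calc h a * (b - a) = ∫ _ in a..b, h a := by
          rw [intervalIntegral.integral_const, smul_eq_mul, mul_comm]
      _ ≤ ∫ y in a..b, h y := intervalIntegral.integral_mono_on hab intervalIntegrable_const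
          (hh.intervalIntegrable _ _) fun y hy => hm hy.1
  · rw [intervalIntegral.integral_symm]
    have : ∫ y in b..a, h y ≤ ∫ _ in b..a, h a := intervalIntegral.integral_mono_on hab
      (hh.intervalIntegrable _ _) intervalIntegrable_const fun y hy => hm hy.2
    rw [intervalIntegral.integral_const, smul_eq_mul] at this
    linarith

/-- First-order optimality on the set of flow allocations, for a sum of functions of the link
rates and functions of the path rates. -/
theorem delay_le_of_isMinOn {h : Link → ℝ → ℝ} {k : Path → ℝ → ℝ} (hh : ∀ l, Continuous (h l))
    (hk : ∀ P, Continuous (k P)) {r : Path → ℝ} (hr : N.IsFeasible r)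
    (hmin : IsMinOn (fun r => (∑ l, ∫ y in (0 : ℝ)..N.linkRate r l, h l y) +
      ∑ P, ∫ y in (0 : ℝ)..r P, k P y) {r | N.IsFeasible r} r)
    {P P' : Path} (hP : 0 < r P) (hPP' : N.source P' = N.source P) :
    (∑ l ∈ N.links P, h l (N.linkRate r l)) + k P (r P) ≤
      (∑ l ∈ N.links P', h l (N.linkRate r l)) + k P' (r P') := by
  -- Moving rate from `P` to `P'` is a feasible direction because `r P > 0`; the one-sided
  -- derivative of the objective along it must be nonnegative.
  set d : Path → ℝ := Pi.single P' 1 - Pi.single P 1 with hd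
  set ψ : ℝ → ℝ := fun s => (∑ l, ∫ y in (0 : ℝ)..N.linkRate (r + s • d) l, h l y) +
      ∑ P, ∫ y in (0 : ℝ)..(r + s • d) P, k P y with hψ
  have hlin : ∀ s l, N.linkRate (r + s • d) l = N.linkRate r l + s * N.linkRate d l := by
    intro s l
    simp [← linkRateCLM_apply]
  have haff : ∀ a b : ℝ, HasDerivAt (fun s : ℝ => a + s * b) b 0 := fun a b => by
    simpa using ((hasDerivAt_id (0 : ℝ)).mul_const b).const_add a
  have hder : HasDerivAt ψ ((∑ l, h l (N.linkRate r l) * N.linkRate d l) +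
      ∑ P, k P (r P) * d P) 0 := by
    refine HasDerivAt.add (HasDerivAt.fun_sum fun l _ => ?_) (HasDerivAt.fun_sum fun R _ => ?_)
    · have h1 := HasDerivAt.comp (0 : ℝ) (hasDerivAt_primitive (hh l)
        (N.linkRate r l + 0 * N.linkRate d l)) (haff (N.linkRate r l) (N.linkRate d l))
      simp only [hlin]
      simpa [Function.comp_def] using h1
    · have h1 := HasDerivAt.comp (0 : ℝ) (hasDerivAt_primitive (hk R) (r R + 0 * d R))
        (haff (r R) (d R))
      simpa [Function.comp_def] using h1
  have hval : (∑ l, h l (N.linkRate r l) * N.linkRate d l) + ∑ P, k P (r P) * d P =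
      ((∑ l ∈ N.links P', h l (N.linkRate r l)) + k P' (r P')) -
        ((∑ l ∈ N.links P, h l (N.linkRate r l)) + k P (r P)) := by
    rw [sum_mul_linkRate, ← Finset.sum_add_distrib]
    simp_rw [← add_mul, hd, Pi.sub_apply, mul_sub, Finset.sum_sub_distrib, Pi.single_apply]
    simp
  rw [hval] at hder
  have hslope := (hasDerivAt_iff_tendsto_slope.1 hder).mono_left
    (nhdsWithin_mono 0 (s := Ioi 0) fun s hs => ne_of_gt hs)
  refine sub_nonneg.1 (ge_of_tendsto hslope ?_)
  filter_upwards [Ioc_mem_nhdsGT hP] with s hs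
  rw [slope_def_field]
  refine div_nonneg (sub_nonneg.2 ?_) (by linarith [hs.1])
  have := hmin (hr.shift hPP' hs.1.le hs.2)
  simpa [hψ, hd] using this

/-- Used twice: `k = 0` produces a Wardrop equilibrium, and a penalty on decreasing path rates
produces an implicit Euler step. -/
theorem exists_delay_le (hN : N.Assumptions) {h : Link → ℝ → ℝ} {k : Path → ℝ → ℝ}
    (hh : ∀ l, Continuous (h l)) (hk : ∀ P, Continuous (k P)) :
    ∃ r, N.IsFeasible r ∧ ∀ P P', 0 < r P → N.source P' = N.source P →
      (∑ l ∈ N.links P, h l (N.linkRate r l)) + k P (r P) ≤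
        (∑ l ∈ N.links P', h l (N.linkRate r l)) + k P' (r P') := by
  have hc : Continuous (fun r => (∑ l, ∫ y in (0 : ℝ)..N.linkRate r l, h l y) +
      ∑ P, ∫ y in (0 : ℝ)..r P, k P y) := by
    refine (continuous_finsetSum _ fun l _ => ?_).add (continuous_finsetSum _ fun P _ => ?_)
    · exact (contDiff_primitive (hh l)).continuous.comp
        ((continuous_apply l).comp N.continuous_linkRate)
    · exact (contDiff_primitive (hk P)).continuous.comp (continuous_apply P)
  obtain ⟨r, hr, hmin⟩ := N.isCompact_isFeasible.exists_isMinOn (exists_isFeasible hN)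
    hc.continuousOn
  exact ⟨r, hr, fun P P' hP hPP' => delay_le_of_isMinOn hh hk hr hmin hP hPP'⟩

/-! ### Wardrop equilibria -/

theorem exists_isWardrop (hN : N.Assumptions) : ∃ r, N.IsWardrop r := by
  obtain ⟨r, hr, h⟩ := exists_delay_le hN (k := fun _ _ => 0) (continuous_totalDelay hN)
    fun _ => continuous_const
  refine ⟨r, hr, fun P hP P' hPP' => ?_⟩
  rw [N.pathDelay_eq_delayAt hr.1]
  simpa [delayAt] using h P P' hP hPP'

variable (N) in
/-- The Beckmann potential of a vector of link rates. -/
def potential (z : Link → ℝ) : ℝ := ∑ l, ∫ y in (0 : ℝ)..z l, N.totalDelay l y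

theorem continuous_potential (hN : N.Assumptions) : Continuous N.potential :=
  continuous_finsetSum _ fun l _ =>
    (contDiff_primitive (continuous_totalDelay hN l)).continuous.comp (continuous_apply l)

theorem sum_delayAt_mul_le_potential_sub (hN : N.Assumptions) (r r' : Path → ℝ) :
    ∑ P, N.delayAt (N.linkRate r) P * (r' P - r P) ≤
      N.potential (N.linkRate r') - N.potential (N.linkRate r) := by
  have h1 := N.sum_mul_linkRate (fun l => N.totalDelay l (N.linkRate r l)) (r' - r)
  simp only [Pi.sub_apply] at h1
  unfold delayAt potential
  rw [← h1, ← Finset.sum_sub_distrib]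
  refine Finset.sum_le_sum fun l _ => ?_
  have := mul_sub_le_primitive_sub (continuous_totalDelay hN l) (totalDelay_monotone hN l)
    (N.linkRate r l) (N.linkRate r' l)
  simpa [← linkRateCLM_apply] using this

/-- The excess of the delay of a path over the minimal delay of its source. -/
def excess (N : OutOfBandNetwork Source Path Link) (q : Path → ℝ) (P : Path) : ℝ :=
  (Finset.univ.filter fun P' => N.source P' = N.source P).sup' ⟨P, by simp⟩ fun P' => q P - q P'

section Excess

variable (q : Path → ℝ)

theorem sub_le_excess {P P' : Path} (h : N.source P' = N.source P) :
    q P - q P' ≤ N.excess q P :=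
  Finset.le_sup' (fun P' => q P - q P') (by simpa using h)

theorem exists_excess_eq (P : Path) :
    ∃ P', N.source P' = N.source P ∧ N.excess q P = q P - q P' := by
  obtain ⟨P', h1, h2⟩ := Finset.exists_mem_eq_sup'
    (s := Finset.univ.filter fun P' => N.source P' = N.source P) ⟨P, by simp⟩ fun P' => q P - q P'
  exact ⟨P', by simpa using h1, h2⟩

theorem excess_nonneg (P : Path) : 0 ≤ N.excess q P := by
  simpa using sub_le_excess (N := N) q (P := P) (P' := P) rfl

theorem excess_eq_zero_iff {P : Path} :
    N.excess q P = 0 ↔ ∀ P', N.source P' = N.source P → q P ≤ q P' := by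
  refine ⟨fun h P' hP' => ?_, fun h => le_antisymm ?_ (excess_nonneg q P)⟩
  · have := sub_le_excess (N := N) q hP'
    linarith
  · obtain ⟨P', h1, h2⟩ := exists_excess_eq (N := N) q P
    have := h P' h1
    linarith

/-- Both sides are the minimal delay of the common source. -/
theorem sub_excess_congr {P R : Path} (h : N.source P = N.source R) :
    q P - N.excess q P = q R - N.excess q R := by
  obtain ⟨P', h1, h2⟩ := exists_excess_eq (N := N) q P
  obtain ⟨R', h3, h4⟩ := exists_excess_eq (N := N) q R
  have h5 := sub_le_excess (N := N) q (P := P) (P' := R') (h3.trans h.symm)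
  have h6 := sub_le_excess (N := N) q (P := R) (P' := P') (h1.trans h)
  linarith

theorem excess_eq_sub {P R : Path} (h : N.source R = N.source P)
    (hR : ∀ P', N.source P' = N.source P → q R ≤ q P') : N.excess q P = q P - q R := by
  have h1 := sub_excess_congr (N := N) q h
  have h2 : N.excess q R = 0 := (excess_eq_zero_iff q).2 fun P' hP' => hR P' (hP'.trans h)
  linarith

theorem exists_isMinPath (hN : N.Assumptions) : ∃ m, N.IsMinPath q m := by
  have : ∀ i, ∃ P, N.source P = i ∧ ∀ P', N.source P' = i → q P ≤ q P' := by
    intro i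
    obtain ⟨P₀, rfl⟩ := hN.exists_path i
    obtain ⟨P, hP, hmin⟩ := Finset.exists_min_image
      (Finset.univ.filter fun P' => N.source P' = N.source P₀) q ⟨P₀, by simp⟩
    exact ⟨P, by simpa using hP, fun P' hP' => hmin P' (by simpa using hP')⟩
  choose m hm using this
  exact ⟨m, hm⟩

/-- The delay and the excess differ by a function of the source alone, which is orthogonal to any
`d` with zero source sums. -/
theorem sum_mul_eq_sum_excess_mul {d : Path → ℝ}
    (hd : ∀ i, ∑ P with N.source P = i, d P = 0) :
    ∑ P, q P * d P = ∑ P, N.excess q P * d P := by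
  rw [← sub_eq_zero, ← Finset.sum_sub_distrib]
  have hc : ∃ c : Source → ℝ, ∀ P, c (N.source P) = q P - N.excess q P := by
    refine ⟨fun i => if h : ∃ P, N.source P = i then q h.choose - N.excess q h.choose else 0, ?_⟩
    intro P
    have h : ∃ R, N.source R = N.source P := ⟨P, rfl⟩
    simp only [dif_pos h]
    exact sub_excess_congr q h.choose_spec
  obtain ⟨c, hc⟩ := hc
  rw [← sum_comp_source_mul c hd]
  refine Finset.sum_congr rfl fun P _ => ?_
  rw [hc]
  ring

end Excess

theorem continuous_excess (P : Path) : Continuous fun q => N.excess q P :=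
  Continuous.finset_sup'_apply _ fun P' _ => (continuous_apply P).sub (continuous_apply P')

theorem isWardrop_iff {r : Path → ℝ} : N.IsWardrop r ↔
    N.IsFeasible r ∧ ∀ P, r P ≠ 0 → N.excess (N.pathDelay r) P = 0 := by
  refine and_congr_right fun hr => forall_congr' fun P => ?_
  rw [excess_eq_zero_iff, (hr.1 P).lt_iff_ne']

theorem IsFeasible.sum_sub_eq_zero {r r' : Path → ℝ} (hr : N.IsFeasible r)
    (hr' : N.IsFeasible r') (i : Source) : ∑ P with N.source P = i, (r' P - r P) = 0 := by
  rw [Finset.sum_sub_distrib, hr.2, hr'.2, sub_self]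

/-- The variational inequality: with delays replaced by excesses, used paths contribute `0` and
unused ones can only gain rate. -/
theorem IsWardrop.sum_nonneg {r r' : Path → ℝ} (hr : N.IsWardrop r) (hr' : N.IsFeasible r') :
    0 ≤ ∑ P, N.delayAt (N.linkRate r) P * (r' P - r P) := by
  rw [sum_mul_eq_sum_excess_mul _ (hr.1.sum_sub_eq_zero hr'), ← N.pathDelay_eq_delayAt hr.1.1]
  refine Finset.sum_nonneg fun P _ => ?_
  by_cases h : r P = 0
  · rw [h, sub_zero]
    exact mul_nonneg (excess_nonneg _ P) (hr'.1 P)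
  · rw [(isWardrop_iff.1 hr).2 P h, zero_mul]

theorem IsWardrop.potential_le (hN : N.Assumptions) {r r' : Path → ℝ} (hr : N.IsWardrop r)
    (hr' : N.IsFeasible r') : N.potential (N.linkRate r) ≤ N.potential (N.linkRate r') := by
  have h1 := sum_delayAt_mul_le_potential_sub hN r r'
  have h2 := hr.sum_nonneg hr'
  linarith

theorem IsWardrop.linkRate_eq (hN : N.Assumptions) {r r' : Path → ℝ} (hr : N.IsWardrop r)
    (hr' : N.IsWardrop r') : N.linkRate r = N.linkRate r' := by
  have h1 := hr.sum_nonneg hr'.1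
  have h2 := hr'.sum_nonneg hr.1
  -- Adding the two variational inequalities bounds a sum of nonnegative terms by zero; any link
  -- whose rates differ would make the sum positive.
  have h3 : ∑ l, (N.totalDelay l (N.linkRate r l) - N.totalDelay l (N.linkRate r' l)) *
      (N.linkRate r l - N.linkRate r' l) ≤ 0 := by
    have h4 := N.sum_mul_linkRate (fun l => N.totalDelay l (N.linkRate r l) -
      N.totalDelay l (N.linkRate r' l)) (r - r')
    have h5 : ∀ l, N.linkRate (r - r') l = N.linkRate r l - N.linkRate r' l := fun l => by
      simp [← linkRateCLM_apply]
    simp only [h5] at h4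
    rw [h4]
    have h6 : ∑ P, (∑ l ∈ N.links P, (N.totalDelay l (N.linkRate r l) -
        N.totalDelay l (N.linkRate r' l))) * (r - r') P =
        -(∑ P, N.delayAt (N.linkRate r) P * (r' P - r P)) -
          ∑ P, N.delayAt (N.linkRate r') P * (r P - r' P) := by
      rw [← Finset.sum_neg_distrib, ← Finset.sum_sub_distrib]
      refine Finset.sum_congr rfl fun P _ => ?_
      rw [Finset.sum_sub_distrib, Pi.sub_apply]
      unfold delayAt
      ring
    rw [h6]
    linarith
  have hpos : ∀ l, N.linkRate r l ≠ N.linkRate r' l →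
      0 < (N.totalDelay l (N.linkRate r l) - N.totalDelay l (N.linkRate r' l)) *
        (N.linkRate r l - N.linkRate r' l) := by
    intro l hl
    have ha := N.linkRate_nonneg hr.1.1 l
    have hb := N.linkRate_nonneg hr'.1.1 l
    rcases lt_or_gt_of_ne hl with h | h
    · exact mul_pos_of_neg_of_neg (sub_neg.2 (totalDelay_strictMonoOn hN l ha hb h))
        (sub_neg.2 h)
    · exact mul_pos (sub_pos.2 (totalDelay_strictMonoOn hN l hb ha h)) (sub_pos.2 h)
  have hnn : ∀ l, 0 ≤ (N.totalDelay l (N.linkRate r l) - N.totalDelay l (N.linkRate r' l)) *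
        (N.linkRate r l - N.linkRate r' l) := by
    intro l
    by_cases h : N.linkRate r l = N.linkRate r' l
    · simp [h]
    · exact (hpos l h).le
  by_contra hne
  obtain ⟨l, hl⟩ := Function.ne_iff.1 hne
  exact absurd h3 (not_le.2 (Finset.sum_pos' (fun l _ => hnn l) ⟨l, Finset.mem_univ l, hpos l hl⟩))

theorem isWardrop_of_potential_le (hN : N.Assumptions) {r rs : Path → ℝ} (hrs : N.IsWardrop rs)
    (hr : N.IsFeasible r) (h : N.potential (N.linkRate r) ≤ N.potential (N.linkRate rs)) :
    N.IsWardrop r := by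
  refine ⟨hr, fun P hP P' hPP' => ?_⟩
  have := delay_le_of_isMinOn (k := fun _ _ => 0) (continuous_totalDelay hN)
    (fun _ => continuous_const) hr (fun r' hr' => by
      simpa [potential] using h.trans (hrs.potential_le hN hr')) hP hPP'
  rw [N.pathDelay_eq_delayAt hr.1]
  simpa [delayAt] using this

/-- Convexity bounds the potential gap by `∑ e_P r_P`, to which Cauchy–Schwarz applies. The summand
`1` keeps the constant positive even if all rates vanish. -/
theorem potential_sub_sq_le (hN : N.Assumptions) {r rs : Path → ℝ} (hrs : N.IsWardrop rs)
    (hr : N.IsFeasible r) :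
    (N.potential (N.linkRate r) - N.potential (N.linkRate rs)) ^ 2 ≤
      (1 + ∑ P, N.rate (N.source P) ^ 2) *
        ∑ P, if r P = 0 then 0 else N.excess (N.pathDelay r) P ^ 2 := by
  set e := N.excess (N.pathDelay r) with he
  have h1 : N.potential (N.linkRate r) - N.potential (N.linkRate rs) ≤
      ∑ P, (if r P = 0 then 0 else e P) * r P := by
    have h2 := sum_delayAt_mul_le_potential_sub hN r rs
    rw [sum_mul_eq_sum_excess_mul _ (hr.sum_sub_eq_zero hrs.1), ← N.pathDelay_eq_delayAt hr.1,
      ← he] at h2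
    have h3 : 0 ≤ ∑ P, e P * rs P :=
      Finset.sum_nonneg fun P _ => mul_nonneg (excess_nonneg _ P) (hrs.1.1 P)
    have h4 : ∑ P, (if r P = 0 then 0 else e P) * r P = ∑ P, e P * r P :=
      Finset.sum_congr rfl fun P _ => by split_ifs with h <;> simp [h]
    simp only [mul_sub, Finset.sum_sub_distrib] at h2
    linarith
  have h0 : 0 ≤ N.potential (N.linkRate r) - N.potential (N.linkRate rs) :=
    sub_nonneg.2 (hrs.potential_le hN hr)
  calc _ ≤ (∑ P, (if r P = 0 then 0 else e P) * r P) ^ 2 := by gcongr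
    _ ≤ (∑ P, (if r P = 0 then 0 else e P) ^ 2) * ∑ P, r P ^ 2 :=
      Finset.sum_mul_sq_le_sq_mul_sq _ _ _
    _ ≤ (∑ P, (if r P = 0 then 0 else e P) ^ 2) * (1 + ∑ P, N.rate (N.source P) ^ 2) := by
      refine mul_le_mul_of_nonneg_left ?_ (Finset.sum_nonneg fun _ _ => sq_nonneg _)
      have : ∑ P, r P ^ 2 ≤ ∑ P, N.rate (N.source P) ^ 2 := Finset.sum_le_sum fun P _ => by
        have := hr.1 P
        have := hr.le_rate P
        gcongr
      linarith
    _ = _ := by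
      rw [mul_comm]
      congr 1
      exact Finset.sum_congr rfl fun P _ => by split_ifs <;> simp

/-! ### Velocities of the flow allocation -/

theorem gatedPart_excess_nonneg (q r : Path → ℝ) (P : Path) :
    0 ≤ gatedPart (N.excess q P) (r P) := by
  unfold gatedPart
  split_ifs
  · exact le_rfl
  · exact excess_nonneg q P

/-- The selected minimal path has excess `0`, so its own gated term vanishes and may be included in
the sum over its source. -/
theorem flowVelocity_eq {q r : Path → ℝ} {m : Source → Path} (hm : N.IsMinPath q m) (P : Path) :
    N.flowVelocity q m r P = -gatedPart (N.excess q P) (r P) +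
      if P = m (N.source P) then
        ∑ P' with N.source P' = N.source P, gatedPart (N.excess q P') (r P') else 0 := by
  have hex : ∀ P', N.excess q P' = q P' - q (m (N.source P')) := fun P' =>
    excess_eq_sub q (hm _).1 (hm _).2
  unfold flowVelocity
  split_ifs with h
  · have hP : gatedPart (N.excess q P) (r P) = 0 := by
      rw [hex, ← h, sub_self]
      simp [gatedPart]
    rw [hP, neg_zero, zero_add, Finset.sum_neg_distrib, neg_neg]
    refine (Finset.sum_congr rfl fun P' hP' => ?_).trans
      (Finset.sum_subset (s₁ := {P' | N.source P' = N.source P ∧ P' ≠ P}) ?_ ?_)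
    · rw [hex, (Finset.mem_filter.1 hP').2.1, ← h]
    · intro P' hP'
      simp only [Finset.mem_filter, Finset.mem_univ, true_and] at hP' ⊢
      exact hP'.1
    · intro P' hP' hP''
      simp only [Finset.mem_filter, Finset.mem_univ, true_and] at hP' hP''
      have : P' = P := by
        by_contra hne
        exact hP'' ⟨hP', hne⟩
      rw [this, hP]
  · rw [hex, add_zero]

/-- The possible velocities of a flow allocation `r` when the path delays are `q`. -/
structure IsVelocity (N : OutOfBandNetwork Source Path Link) (q r v : Path → ℝ) : Prop where
  sum_eq_zero : ∀ i, ∑ P with N.source P = i, v P = 0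
  of_excess_pos : ∀ P, 0 < N.excess q P → v P = if r P = 0 then 0 else -N.excess q P
  nonneg : ∀ P, N.excess q P = 0 → 0 ≤ v P

theorem convex_isVelocity (q r : Path → ℝ) : Convex ℝ {v | N.IsVelocity q r v} := by
  intro v hv w hw a b ha hb hab
  refine ⟨fun i => ?_, fun P hP => ?_, fun P hP => ?_⟩
  · simp only [Pi.add_apply, Pi.smul_apply, Finset.sum_add_distrib, ← Finset.smul_sum,
      hv.sum_eq_zero, hw.sum_eq_zero, smul_zero, add_zero]
  · simp only [Pi.add_apply, Pi.smul_apply, hv.of_excess_pos P hP, hw.of_excess_pos P hP]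
    rw [← add_smul, hab, one_smul]
  · exact add_nonneg (mul_nonneg ha (hv.nonneg P hP)) (mul_nonneg hb (hw.nonneg P hP))

theorem isVelocity_flowVelocity {q r : Path → ℝ} {m : Source → Path} (hm : N.IsMinPath q m) :
    N.IsVelocity q r (N.flowVelocity q m r) := by
  refine ⟨fun i => ?_, fun P hP => ?_, fun P hP => ?_⟩
  · have : ∀ P ∈ Finset.univ.filter fun P => N.source P = i, N.flowVelocity q m r P =
        -gatedPart (N.excess q P) (r P) + if P = m i then
          ∑ P' with N.source P' = i, gatedPart (N.excess q P') (r P') else 0 := by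
      intro P hP
      rw [flowVelocity_eq hm, (Finset.mem_filter.1 hP).2]
    rw [Finset.sum_congr rfl this, Finset.sum_add_distrib, Finset.sum_ite_eq',
      if_pos (by simp [(hm i).1]), Finset.sum_neg_distrib, neg_add_cancel]
  · rw [flowVelocity_eq hm, if_neg, add_zero]
    · unfold gatedPart
      by_cases h : r P = 0 <;> simp [h, hP]
    · intro h
      refine hP.ne' ((excess_eq_zero_iff q).2 fun P' hP' => ?_)
      rw [h]
      exact (hm _).2 P' hP'
  · rw [flowVelocity_eq hm, hP]
    have h1 : gatedPart 0 (r P) = 0 := by simp [gatedPart]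
    rw [h1, neg_zero, zero_add]
    split_ifs
    · exact Finset.sum_nonneg fun P' _ => gatedPart_excess_nonneg q r P'
    · exact le_rfl

theorem IsVelocity.eq_neg_gatedPart {q r v : Path → ℝ} (hv : N.IsVelocity q r v) {P : Path}
    (hP : 0 < N.excess q P) : v P = -gatedPart (N.excess q P) (r P) := by
  rw [hv.of_excess_pos P hP]
  unfold gatedPart
  by_cases h : r P = 0 <;> simp [h, hP]

/-- Every velocity that the characterization allows is a convex combination of velocities that
belong to selections of minimal paths. -/
theorem IsVelocity.mem_convexHull (hN : N.Assumptions) {q r v : Path → ℝ}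
    (hv : N.IsVelocity q r v) :
    v ∈ convexHull ℝ {v | ∃ m, N.IsMinPath q m ∧ v = N.flowVelocity q m r} := by
  have : Finite Source := Finite.of_surjective N.source hN.exists_path
  obtain ⟨m₀, hm₀⟩ := exists_isMinPath (N := N) q hN
  set w : Path → ℝ := fun P => gatedPart (N.excess q P) (r P) with hw
  -- `D i` is the rate released per unit time by the paths of source `i`. The vector `g i p` hands
  -- all of it to the minimal path `p`, while `u i` distributes it as `v` does.
  set D : Source → ℝ := fun i => ∑ P with N.source P = i, w P with hD
  set g : Source → Path → Path → ℝ := fun i p P => -w P + if P = p then D i else 0 with hg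
  set S : Source → Set (Path → ℝ) := fun i =>
    {u | ∃ p, (N.source p = i ∧ ∀ P, N.source P = i → q p ≤ q P) ∧ u = g i p} with hS
  set u : Source → Path → ℝ := fun i P =>
    -w P + if N.source P = i ∧ N.excess q P = 0 then v P else 0 with hu
  have huS : ∀ i, u i ∈ convexHull ℝ (S i) := by
    intro i
    set M : Finset Path := Finset.univ.filter fun P => N.source P = i ∧ N.excess q P = 0 with hM
    have hMmin : ∀ p ∈ M, N.source p = i ∧ ∀ P, N.source P = i → q p ≤ q P := by
      intro p hp
      obtain ⟨h1, h2⟩ := (Finset.mem_filter.1 hp).2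
      exact ⟨h1, fun P hP => (excess_eq_zero_iff q).1 h2 P (hP.trans h1.symm)⟩
    -- The entries of `v` on a source sum to zero and equal `-w` off `M`, while `w` vanishes on `M`.
    have hsum : ∑ P ∈ M, v P = D i := by
      have h1 : ∑ P with N.source P = i, (v P + w P) = D i := by
        rw [Finset.sum_add_distrib, hv.sum_eq_zero, zero_add]
      rw [← h1]
      refine (Finset.sum_congr rfl fun P hP => ?_).trans (Finset.sum_subset (s₁ := M) ?_ ?_)
      · simp [hw, gatedPart, (Finset.mem_filter.1 hP).2.2]
      · intro P hP
        simpa using (Finset.mem_filter.1 hP).2.1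
      · intro P hP hPM
        have h2 : N.source P = i := by simpa using hP
        have h3 : 0 < N.excess q P := (excess_nonneg q P).lt_of_ne' fun h0 =>
          hPM (by simp [hM, h2, h0])
        rw [hv.eq_neg_gatedPart h3]
        simp [hw]
    have hv0 : ∀ P ∈ M, 0 ≤ v P := fun P hP => hv.nonneg P (Finset.mem_filter.1 hP).2.2
    by_cases hDi : D i = 0
    · have h1 : u i = g i (m₀ i) := by
        ext P
        have h2 : (if N.source P = i ∧ N.excess q P = 0 then v P else 0) = 0 := by
          split_ifs with h
          · exact (Finset.sum_eq_zero_iff_of_nonneg hv0).1 (hsum.trans hDi) P (by simp [hM, h])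
          · rfl
        simp [hu, hg, h2, hDi]
      rw [h1]
      exact subset_convexHull ℝ _ ⟨m₀ i, hm₀ i, rfl⟩
    -- The convex weights are the shares of the released rate that `v` gives to each minimal path.
    · have h1 : u i = ∑ p ∈ M, (v p / D i) • g i p := by
        ext P
        rw [Finset.sum_apply]
        have h2 : ∀ p ∈ M, ((v p / D i) • g i p) P =
            (v p / D i) * -w P + if P = p then v p else 0 := by
          intro p _
          simp only [hg, Pi.smul_apply, smul_eq_mul, mul_add]
          split_ifs
          · rw [div_mul_cancel₀ _ hDi]
          · rw [mul_zero]
        rw [Finset.sum_congr rfl h2, Finset.sum_add_distrib, ← Finset.sum_mul, ← Finset.sum_div,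
          hsum, div_self hDi, one_mul, Finset.sum_ite_eq]
        simp [hu, hM]
      rw [h1]
      have hDpos : 0 ≤ D i := Finset.sum_nonneg fun P _ => gatedPart_excess_nonneg q r P
      refine (convex_convexHull ℝ (S i)).sum_mem (fun p hp => div_nonneg (hv0 p hp) hDpos) ?_
        fun p hp => subset_convexHull ℝ _ ⟨p, hMmin p hp, rfl⟩
      rw [← Finset.sum_div, hsum, div_self hDi]
  -- Sources select independently, so hulls per source combine into the hull of the product; the
  -- linear map `φ` then reads each path from the component of its own source.
  have hpi : u ∈ convexHull ℝ (univ.pi S) := mem_convexHull_pi fun i _ => huS i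
  let φ : (Source → Path → ℝ) →ₗ[ℝ] (Path → ℝ) :=
    { toFun := fun u P => u (N.source P) P
      map_add' := fun _ _ => rfl
      map_smul' := fun _ _ => rfl }
  have hφ : v = φ u := by
    ext P
    change v P = -w P + if N.source P = N.source P ∧ N.excess q P = 0 then v P else 0
    by_cases h : N.excess q P = 0
    · simp [h, hw, gatedPart]
    · simp [h, hw, hv.eq_neg_gatedPart ((excess_nonneg q P).lt_of_ne' h)]
  have himg : v ∈ φ '' convexHull ℝ (univ.pi S) := ⟨u, hpi, hφ.symm⟩
  rw [φ.image_convexHull] at himg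
  refine convexHull_mono ?_ himg
  rintro _ ⟨y, hy, rfl⟩
  choose m hm hym using fun i => hy i (mem_univ i)
  refine ⟨m, hm, ?_⟩
  ext P
  rw [flowVelocity_eq hm]
  change y (N.source P) P = _
  rw [hym]

theorem mem_convexHull_flowVelocity_iff (hN : N.Assumptions) {q r v : Path → ℝ} :
    v ∈ convexHull ℝ {v | ∃ m, N.IsMinPath q m ∧ v = N.flowVelocity q m r} ↔
      N.IsVelocity q r v := by
  refine ⟨fun h => convexHull_min ?_ (convex_isVelocity q r) h, fun h => h.mem_convexHull hN⟩
  rintro _ ⟨m, hm, rfl⟩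
  exact isVelocity_flowVelocity hm

theorem isWardrop_iff_isVelocity_zero {r : Path → ℝ} (hr : N.IsFeasible r) :
    N.IsWardrop r ↔ N.IsVelocity (N.pathDelay r) r 0 := by
  rw [isWardrop_iff]
  constructor
  · rintro ⟨-, h⟩
    refine ⟨fun i => by simp, fun P hP => ?_, fun P _ => le_rfl⟩
    rw [if_pos]
    · rfl
    · by_contra h0
      exact hP.ne' (h P h0)
  · intro h
    refine ⟨hr, fun P hP => ?_⟩
    by_contra h0
    have h1 := h.of_excess_pos P ((excess_nonneg _ P).lt_of_ne' h0)
    rw [if_neg hP, Pi.zero_apply, zero_eq_neg] at h1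
    exact h0 h1

/-- The dissipation identity: with `q` the current path delays, the left side is the derivative of
the potential along the velocity `v`. -/
theorem IsVelocity.sum_mul_eq {q r v : Path → ℝ} (hv : N.IsVelocity q r v) :
    ∑ P, q P * v P = -∑ P, if r P = 0 then 0 else N.excess q P ^ 2 := by
  rw [sum_mul_eq_sum_excess_mul q hv.sum_eq_zero, ← Finset.sum_neg_distrib]
  refine Finset.sum_congr rfl fun P _ => ?_
  rcases (excess_nonneg (N := N) q P).eq_or_lt with h | h
  · simp [← h]
  · rw [hv.of_excess_pos P h]
    split_ifs <;> ring

/-! ### The interconnection -/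

/-- The reference delays at `rs` cancel against the constants subtracted in the outputs of `H₂` and
`H₃`, so the dynamics do not depend on `rs`. -/
theorem mem_interconnection_iff (hN : N.Assumptions) {rs : Path → ℝ} {x v : State Path Link} :
    v ∈ N.interconnection rs x ↔
      N.IsVelocity (fun P => ∑ l ∈ N.links P, (N.linkDelay l (x.2.1 l) + N.leashDelay l (x.2.2 l)))
        x.1 v.1 ∧ v.2 = (N.linkRate v.1, N.linkRate v.1) := by
  have hq : N.pathDelay rs - -(N.incidence.transpose.mulVec
      ((fun l => N.linkDelay l (x.2.1 l) - N.linkDelay l (N.linkRate rs l)) +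
        fun l => N.leashDelay l (x.2.2 l) - N.leashDelay l (N.linkRate rs l))) =
      fun P => ∑ l ∈ N.links P, (N.linkDelay l (x.2.1 l) + N.leashDelay l (x.2.2 l)) := by
    ext P
    simp only [Pi.sub_apply, Pi.neg_apply, sub_neg_eq_add, Matrix.mulVec, dotProduct,
      Matrix.transpose_apply, incidence, ite_mul, one_mul, zero_mul, Pi.add_apply, pathDelay]
    rw [← Finset.sum_filter, Finset.filter_mem_eq_inter, Finset.univ_inter,
      ← Finset.sum_add_distrib]
    exact Finset.sum_congr rfl fun l _ => by ring
  obtain ⟨v₁, v₂, v₃⟩ := v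
  constructor
  · rintro ⟨y₁, y₂, y₃, h₁, ⟨h₂, h₂'⟩, h₃, h₃'⟩
    dsimp only at h₂ h₂' h₃ h₃'
    subst h₂' h₃'
    obtain ⟨h₁, h₁'⟩ := h₁
    dsimp only at h₁ h₁'
    subst h₁'
    rw [hq, mem_convexHull_flowVelocity_iff hN] at h₁
    exact ⟨h₁, Prod.ext h₂ h₃⟩
  · rintro ⟨h₁, h₂⟩
    dsimp only at h₁ h₂
    obtain ⟨rfl, rfl⟩ := Prod.mk.inj h₂
    refine ⟨v₁, _, _, ⟨?_, rfl⟩, ⟨rfl, rfl⟩, rfl, rfl⟩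
    rw [hq, mem_convexHull_flowVelocity_iff hN]
    exact h₁

theorem mem_interconnection_stateOf_iff (hN : N.Assumptions) {rs r : Path → ℝ}
    {v : State Path Link} :
    v ∈ N.interconnection rs (N.stateOf r) ↔
      N.IsVelocity (N.pathDelay r) r v.1 ∧ v.2 = (N.linkRate v.1, N.linkRate v.1) :=
  mem_interconnection_iff hN

theorem equilibria_eq (hN : N.Assumptions) (rs : Path → ℝ) :
    N.equilibria rs = N.stateOf '' {r | N.IsWardrop r} := by
  have hA : N.linkRate 0 = 0 := N.linkRateCLM.map_zero
  ext x
  constructor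
  · rintro ⟨⟨r, hr, rfl⟩, h⟩
    refine ⟨r, ?_, rfl⟩
    exact (isWardrop_iff_isVelocity_zero hr).2 ((mem_interconnection_stateOf_iff hN).1 h).1
  · rintro ⟨r, hr, rfl⟩
    refine ⟨⟨r, hr.1, rfl⟩, (mem_interconnection_stateOf_iff hN).2
      ⟨(isWardrop_iff_isVelocity_zero hr.1).1 hr, ?_⟩⟩
    simp only [Prod.fst_zero, Prod.snd_zero, hA, Prod.mk_zero_zero]

/-! ### Trajectories -/

variable {rs : Path → ℝ} {x : ℝ → State Path Link}

theorem snd_eq_of_mem_trajectories (hN : N.Assumptions) (hx : x ∈ N.trajectories rs) {t : ℝ}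
    (ht : 0 ≤ t) : (x t).2 = (N.linkRate (x t).1, N.linkRate (x t).1) := by
  obtain ⟨r, -, hr0⟩ := hx.init
  let L : State Path Link →L[ℝ] (Link → ℝ) × (Link → ℝ) :=
    ContinuousLinearMap.snd ℝ _ _ -
      (N.linkRateCLM.prod N.linkRateCLM).comp (ContinuousLinearMap.fst ℝ _ _)
  have hL : ∀ s, L s = s.2 - (N.linkRate s.1, N.linkRate s.1) := fun s => rfl
  have h := eq_of_ae_hasDerivAt_zero (f := fun t => L (x t))
    (fun T hT => (hx.ac T hT).comp_clm L) (by
      filter_upwards [hx.deriv] with t ⟨v, hv, hder⟩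
      have h1 := L.hasFDerivAt.comp_hasDerivAt t hder
      rwa [hL, ((mem_interconnection_iff hN).1 hv).2, sub_self] at h1) ht
  simp only [hL, ← hr0] at h
  rw [show (N.stateOf r).2 = (N.linkRate (N.stateOf r).1, N.linkRate (N.stateOf r).1) from rfl,
    sub_self, sub_eq_zero] at h
  exact h

theorem eq_stateOf_of_mem_trajectories (hN : N.Assumptions) (hx : x ∈ N.trajectories rs) {t : ℝ}
    (ht : 0 ≤ t) : x t = N.stateOf (x t).1 :=
  Prod.ext rfl (snd_eq_of_mem_trajectories hN hx ht)

theorem isFeasible_of_mem_trajectories (hN : N.Assumptions) (hx : x ∈ N.trajectories rs) {t : ℝ}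
    (ht : 0 ≤ t) : N.IsFeasible (x t).1 := by
  obtain ⟨r, hr, hr0⟩ := hx.init
  refine ⟨hx.mem t ht, fun i => ?_⟩
  let L : State Path Link →L[ℝ] ℝ :=
    (∑ P with N.source P = i, ContinuousLinearMap.proj P).comp (ContinuousLinearMap.fst ℝ _ _)
  have hL : ∀ s, L s = ∑ P with N.source P = i, s.1 P := fun s => by simp [L]
  have h := eq_of_ae_hasDerivAt_zero (f := fun t => L (x t))
    (fun T hT => (hx.ac T hT).comp_clm L) (by
      filter_upwards [hx.deriv] with t ⟨v, hv, hder⟩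
      have h1 := L.hasFDerivAt.comp_hasDerivAt t hder
      rwa [hL, ((mem_interconnection_iff hN).1 hv).1.sum_eq_zero] at h1) ht
  simp only [hL, ← hr0] at h
  rw [h]
  exact hr.2 i

theorem absolutelyContinuousOnInterval_potential (hN : N.Assumptions)
    (hx : x ∈ N.trajectories rs) {T : ℝ} (hT : 0 ≤ T) :
    AbsolutelyContinuousOnInterval (fun t => N.potential (N.linkRate (x t).1)) 0 T := by
  have hl : ∀ l ∈ Finset.univ, AbsolutelyContinuousOnInterval
      (fun t => ∫ y in (0 : ℝ)..N.linkRate (x t).1 l, N.totalDelay l y) 0 T := by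
    intro l _
    have h₁ := (hx.ac T hT).comp_clm (((ContinuousLinearMap.proj l).comp N.linkRateCLM).comp
      (ContinuousLinearMap.fst ℝ (Path → ℝ) _))
    have h : AbsolutelyContinuousOnInterval (fun t => N.linkRate (x t).1 l) 0 T := h₁
    have h' := AbsolutelyContinuousOnInterval.comp_contDiff
      (contDiff_primitive (continuous_totalDelay hN l)) h
    exact h'
  exact AbsolutelyContinuousOnInterval.finset_sum Finset.univ hl

/-- The chain rule and the dissipation identity feed `potential_sub_sq_le` into the scalar
differential inequality. -/
theorem potential_along_trajectory (hN : N.Assumptions) (hrs : N.IsWardrop rs)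
    (hx : x ∈ N.trajectories rs) :
    AntitoneOn (fun t => N.potential (N.linkRate (x t).1)) (Ici 0) ∧
      Tendsto (fun t => N.potential (N.linkRate (x t).1)) atTop
        (𝓝 (N.potential (N.linkRate rs))) := by
  have hC : 0 < 1 + ∑ P, N.rate (N.source P) ^ 2 :=
    add_pos_of_pos_of_nonneg one_pos (Finset.sum_nonneg fun _ _ => sq_nonneg _)
  let L : Link → State Path Link →L[ℝ] ℝ := fun l =>
    ((ContinuousLinearMap.proj l).comp N.linkRateCLM).comp (ContinuousLinearMap.fst ℝ _ _)
  have hL : ∀ l s, L l s = N.linkRate s.1 l := fun _ _ => rfl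
  refine antitoneOn_and_tendsto_of_deriv_le_neg_sq hC
    (fun T hT => absolutelyContinuousOnInterval_potential hN hx hT)
    (fun t ht => hrs.potential_le hN (isFeasible_of_mem_trajectories hN hx ht)) ?_
  · filter_upwards [hx.deriv, ae_restrict_mem measurableSet_Ici] with t ⟨v, hv, hder⟩ ht
    have hr := isFeasible_of_mem_trajectories hN hx ht
    rw [eq_stateOf_of_mem_trajectories hN hx ht, mem_interconnection_stateOf_iff hN] at hv
    have hz : ∀ l, HasDerivAt (fun s => N.linkRate (x s).1 l) (N.linkRate v.1 l) t := fun l => by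
      have h := (L l).hasFDerivAt.comp_hasDerivAt t hder
      simp only [hL, Function.comp_def] at h
      exact h
    have hV : HasDerivAt (fun s => N.potential (N.linkRate (x s).1))
        (∑ l, N.totalDelay l (N.linkRate (x t).1 l) * N.linkRate v.1 l) t := by
      refine HasDerivAt.fun_sum fun l _ => ?_
      exact (hasDerivAt_primitive (continuous_totalDelay hN l)
        (N.linkRate (x t).1 l)).comp t (hz l)
    have h1 := hv.1.sum_mul_eq
    rw [N.pathDelay_eq_delayAt hr.1] at h1
    rw [hV.deriv, sum_mul_linkRate]
    refine h1.trans_le (neg_le_neg ?_)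
    rw [← N.pathDelay_eq_delayAt hr.1, div_le_iff₀' hC]
    exact potential_sub_sq_le hN hrs hr

/-! ### Existence of trajectories -/

/-- One step of the implicit Euler scheme. -/
theorem exists_implicit_step (hN : N.Assumptions) {r₀ : Path → ℝ} (hr₀ : N.IsFeasible r₀) {τ : ℝ}
    (hτ : 0 < τ) : ∃ r, N.IsFeasible r ∧ ∀ P,
      -(τ * N.excess (N.delayAt (N.linkRate r)) P) ≤ r P - r₀ P ∧
      (0 < r P → 0 < N.excess (N.delayAt (N.linkRate r)) P →
        r P - r₀ P ≤ -(τ * N.excess (N.delayAt (N.linkRate r)) P)) := by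
  -- This `k` is the derivative of the proximal penalty `(r₀ P - x)₊² / (2τ)`. Only decreases are
  -- penalized: paths shed rate at the speed of their excess, and minimal paths absorb it freely.
  obtain ⟨r, hr, hQ⟩ := exists_delay_le hN (k := fun P x => -(max (r₀ P - x) 0 / τ))
    (continuous_totalDelay hN) fun P => by fun_prop
  set q := N.delayAt (N.linkRate r) with hq
  replace hQ : ∀ P P', 0 < r P → N.source P' = N.source P →
      q P + -(max (r₀ P - r P) 0 / τ) ≤ q P' + -(max (r₀ P' - r P') 0 / τ) := hQ
  refine ⟨r, hr, fun P => ⟨?_, fun hP he => ?_⟩⟩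
  · rcases le_or_gt (r₀ P) (r P) with h | h
    · have := mul_nonneg hτ.le (excess_nonneg (N := N) q P)
      linarith
    -- Source totals are fixed, so a loss on `P` is a gain on some `R`. There the penalty is
    -- inactive, and optimality of `R` against `P` bounds the loss.
    · obtain ⟨R, hR, hlt⟩ : ∃ R, N.source R = N.source P ∧ r₀ R < r R := by
        by_contra! hcon
        refine absurd (hr₀.sum_sub_eq_zero hr (N.source P)) (ne_of_lt ?_)
        refine Finset.sum_neg' (fun R hR => ?_) ⟨P, by simp, sub_neg.2 h⟩
        exact sub_nonpos.2 (hcon R (by simpa using hR))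
      have h1 := hQ R P ((hr₀.1 R).trans_lt hlt) hR.symm
      rw [max_eq_right (by linarith), max_eq_left (by linarith), zero_div, neg_zero,
        add_zero] at h1
      have h2 := sub_le_excess (N := N) q hR
      have h3 : (r₀ P - r P) / τ ≤ N.excess q P := by linarith
      rw [div_le_iff₀' hτ] at h3
      linarith
  · obtain ⟨R, hR, hRe⟩ := exists_excess_eq (N := N) q P
    have h1 := hQ P R hP hR
    have h2 : 0 ≤ max (r₀ R - r R) 0 / τ := div_nonneg (le_max_right _ _) hτ.le
    have h3 : N.excess q P ≤ max (r₀ P - r P) 0 / τ := by linarith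
    rw [le_div_iff₀' hτ] at h3
    have h4 : 0 < τ * N.excess q P := mul_pos hτ he
    rcases max_cases (r₀ P - r P) 0 with ⟨h5, -⟩ | ⟨h5, -⟩ <;> rw [h5] at h3 <;> linarith

theorem continuous_excess_delayAt (hN : N.Assumptions) (P : Path) :
    Continuous fun r => N.excess (N.delayAt (N.linkRate r)) P :=
  (continuous_excess P).comp ((continuous_delayAt hN).comp N.continuous_linkRate)

theorem exists_excess_bound (hN : N.Assumptions) :
    ∃ M, 0 ≤ M ∧ ∀ r, N.IsFeasible r → ∀ P, N.excess (N.delayAt (N.linkRate r)) P ≤ M := by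
  have h := fun P => N.isCompact_isFeasible.bddAbove_image
    (continuous_excess_delayAt hN P).continuousOn
  choose b hb using h
  refine ⟨∑ P, max (b P) 0, Finset.sum_nonneg fun P _ => le_max_right _ _, fun r hr P => ?_⟩
  calc N.excess (N.delayAt (N.linkRate r)) P ≤ max (b P) 0 :=
        (hb P ⟨r, hr, rfl⟩).trans (le_max_left _ _)
    _ ≤ ∑ P, max (b P) 0 :=
        Finset.single_le_sum (f := fun P => max (b P) 0) (fun _ _ => le_max_right _ _)
          (Finset.mem_univ P)

/-- Fixed source totals turn lower bounds on all increments into upper bounds: a path gains at most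
what the others lose. -/
theorem dist_le_of_neg_le {r r₀ : Path → ℝ} (hr : N.IsFeasible r) (hr₀ : N.IsFeasible r₀) {c : ℝ}
    (hc : 0 ≤ c) (h : ∀ P, -c ≤ r P - r₀ P) : Dist.dist r r₀ ≤ (Fintype.card Path + 1) * c := by
  refine (dist_pi_le_iff (by positivity)).2 fun P => ?_
  rw [Real.dist_eq, abs_le]
  constructor
  · have := h P
    have : 0 ≤ (Fintype.card Path : ℝ) * c := by positivity
    linarith
  · have h0 := hr₀.sum_sub_eq_zero hr (N.source P)
    have hmem : P ∈ Finset.univ.filter fun R => N.source R = N.source P := by simp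
    rw [← Finset.add_sum_erase _ _ hmem] at h0
    have h1 : ∑ R ∈ (Finset.univ.filter fun R => N.source R = N.source P).erase P, -c ≤
        ∑ R ∈ (Finset.univ.filter fun R => N.source R = N.source P).erase P, (r R - r₀ R) :=
      Finset.sum_le_sum fun R _ => h R
    rw [Finset.sum_const, nsmul_eq_mul] at h1
    have h2 : ((((Finset.univ.filter fun R => N.source R = N.source P).erase P).card : ℕ) : ℝ) ≤
        Fintype.card Path := by exact_mod_cast Finset.card_le_univ _
    have h3 := mul_le_mul_of_nonneg_right h2 hc
    linarith

/-- Excess is continuous in `r`, so the inequalities of the implicit step pass to the derivative of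
the limit. The bound on `v` from above is needed only where the path rate and the excess are both
positive, which is an open condition. -/
theorem exists_flow (hN : N.Assumptions) {r₀ : Path → ℝ} (hr₀ : N.IsFeasible r₀) :
    ∃ (x : ℝ → Path → ℝ) (B : NNReal), LipschitzWith B x ∧ x 0 = r₀ ∧ (∀ t, N.IsFeasible (x t)) ∧
      ∀ t v, 0 ≤ t → HasDerivAt x v t → N.IsVelocity (N.pathDelay (x t)) (x t) v := by
  obtain ⟨M, hM, hbound⟩ := exists_excess_bound hN
  have hτ : ∀ n : ℕ, (0 : ℝ) < 1 / (n + 1) := fun n => by positivity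
  choose next hnext hnextP using fun (n : ℕ) (r : {r // N.IsFeasible r}) =>
    exists_implicit_step hN r.2 (hτ n)
  let ρ : ℕ → ℕ → {r // N.IsFeasible r} := fun n k =>
    Nat.rec ⟨r₀, hr₀⟩ (fun _ r => ⟨next n r, hnext n r⟩) k
  have hρ : ∀ n k, (ρ n (k + 1)).1 = next n (ρ n k) := fun n k => rfl
  obtain ⟨x, hLip, hx0, hxK, hx⟩ := exists_limit_of_discrete_curves N.isCompact_isFeasible
    (B := (Fintype.card Path + 1) * M) (by positivity) (fun n k => (ρ n k).1) (x₀ := r₀)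
    (fun n => rfl) (fun n k => (ρ n k).2) (fun n k => by
      refine (dist_le_of_neg_le (ρ n (k + 1)).2 (ρ n k).2 (c := 1 / (n + 1) * M) (by positivity)
        fun P => ?_).trans_eq (by ring)
      refine le_trans (neg_le_neg ?_) (hnextP n (ρ n k) P).1
      exact mul_le_mul_of_nonneg_left (hbound _ (hnext n _) P) (hτ n).le)
  refine ⟨x, _, hLip, hx0, hxK, fun t v ht hv => ?_⟩
  have hvP : ∀ P, HasDerivAt (fun s => x s P) (v P) t := fun P => (hasDerivAt_pi.1 hv) P
  -- A nonnegative coordinate that vanishes at `t` has a minimum there; this supplies the gated case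
  -- of the dynamics.
  have hzero : ∀ P, x t P = 0 → v P = 0 := by
    intro P hP
    refine IsLocalMin.hasDerivAt_eq_zero (Eventually.of_forall fun s => ?_) (hvP P)
    simp only [hP]
    exact (hxK s).1 P
  rw [N.pathDelay_eq_delayAt (hxK t).1]
  set e : Path → (Path → ℝ) → ℝ := fun P r => N.excess (N.delayAt (N.linkRate r)) P with he
  have hlow : ∀ P, -e P (x t) ≤ v P := by
    intro P
    suffices -v P ≤ e P (x t) by linarith
    refine le_of_forall_pos_le_add fun ε hε => ?_
    obtain ⟨δ, hδ, hclose⟩ := Metric.eventually_nhds_iff.1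
      ((continuous_excess_delayAt hN P).continuousAt.eventually_lt_const
        (show e P (x t) < e P (x t) + ε by linarith))
    refine hx t v ht hv (-(ContinuousLinearMap.proj P)) (e P (x t) + ε) δ hδ fun n k hd => ?_
    have h1 := (hnextP n (ρ n k) P).1
    have h2 := mul_le_mul_of_nonneg_left (hclose hd).le (hτ n).le
    simp only [neg_apply, ContinuousLinearMap.proj_apply, Pi.sub_apply, hρ]
    rw [hρ] at h2
    rw [div_eq_mul_one_div, mul_comm]
    linarith
  have hup : ∀ P, 0 < x t P → 0 < e P (x t) → v P ≤ -e P (x t) := by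
    intro P hP hPe
    refine le_of_forall_pos_le_add fun ε hε => ?_
    have hc := (continuous_excess_delayAt hN P).continuousAt (x := x t)
    obtain ⟨δ, hδ, hclose⟩ := Metric.eventually_nhds_iff.1
      ((hc.eventually_const_lt (show e P (x t) - ε < e P (x t) by linarith)).and
        ((hc.eventually_const_lt hPe).and
          ((continuous_apply P).continuousAt.eventually_const_lt hP)))
    refine hx t v ht hv (ContinuousLinearMap.proj P) (-e P (x t) + ε) δ hδ fun n k hd => ?_
    obtain ⟨h1, h2, h3⟩ := hclose hd
    have h4 := (hnextP n (ρ n k) P).2 h3 h2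
    have h5 := mul_le_mul_of_nonneg_left h1.le (hτ n).le
    simp only [ContinuousLinearMap.proj_apply, Pi.sub_apply, hρ]
    rw [hρ] at h5
    rw [div_eq_mul_one_div, mul_comm]
    linarith
  refine ⟨fun i => ?_, fun P hP => ?_, fun P hP => ?_⟩
  · have h1 : HasDerivAt (fun s => ∑ P with N.source P = i, x s P)
        (∑ P with N.source P = i, v P) t := HasDerivAt.fun_sum fun P _ => hvP P
    have h2 : (fun s => ∑ P with N.source P = i, x s P) = fun _ => N.rate i :=
      funext fun s => (hxK s).2 i
    rw [h2] at h1
    exact h1.unique (hasDerivAt_const t _)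
  · split_ifs with h
    · exact hzero P h
    · exact le_antisymm (hup P (((hxK t).1 P).lt_of_ne' h) hP) (hlow P)
  · have := hlow P
    simp only [he, hP] at this
    linarith

variable (N) in
/-- The joint state of a flow allocation as a continuous linear map. -/
def stateCLM : (Path → ℝ) →L[ℝ] State Path Link :=
  (ContinuousLinearMap.id ℝ _).prod (N.linkRateCLM.prod N.linkRateCLM)

theorem exists_trajectory (hN : N.Assumptions) (rs : Path → ℝ) {s : State Path Link}
    (hs : s ∈ N.feasibleStates) : ∃ x ∈ N.trajectories rs, x 0 = s := by
  obtain ⟨r₀, hr₀, rfl⟩ := hs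
  obtain ⟨x, B, hLip, hx0, hxK, hx⟩ := exists_flow hN hr₀
  refine ⟨fun t => N.stateCLM (x t), ⟨⟨x 0, hxK 0, rfl⟩, fun t _ => (hxK t).1, fun T _ => ?_, ?_⟩,
    congrArg N.stateCLM hx0⟩
  · have h := (hLip.lipschitzOnWith (s := uIcc 0 T)).absolutelyContinuousOnInterval
    exact h.comp_clm N.stateCLM
  · filter_upwards [ae_restrict_of_ae hLip.ae_differentiableAt, ae_restrict_mem measurableSet_Ici]
      with t hd ht
    refine ⟨N.stateCLM (deriv x t), ?_, N.stateCLM.hasFDerivAt.comp_hasDerivAt t hd.hasDerivAt⟩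
    exact (mem_interconnection_stateOf_iff hN).2 ⟨hx t _ ht hd.hasDerivAt, rfl⟩

/-! ### Stability -/

variable (N) in
theorem isCompact_feasibleStates : IsCompact N.feasibleStates :=
  N.isCompact_isFeasible.image N.stateCLM.continuous

theorem isGAS_equilibria (hN : N.Assumptions) {rs : Path → ℝ} (hrs : N.IsWardrop rs) :
    IsGAS (N.trajectories rs) N.feasibleStates (N.equilibria rs) := by
  refine isGAS_of_lyapunov (V := fun s => N.potential s.2.1)
    (m := N.potential (N.linkRate rs)) N.isCompact_feasibleStates
    ((continuous_potential hN).comp continuous_snd.fst).continuousOn (fun s hs => hs.1)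
    ?_ ?_ ?_ (fun s hs => exists_trajectory hN rs hs) ?_ ?_ ?_
  · rw [equilibria_eq hN]
    exact ⟨_, rs, hrs, rfl⟩
  · rw [equilibria_eq hN]
    rintro _ ⟨r, hr, rfl⟩
    exact congrArg N.potential (IsWardrop.linkRate_eq hN hr hrs)
  · rw [equilibria_eq hN]
    rintro _ ⟨r, hr, rfl⟩ hne
    by_contra! hle
    exact hne ⟨r, isWardrop_of_potential_le hN hrs hr hle, rfl⟩
  · intro x hx t ht
    exact ⟨_, isFeasible_of_mem_trajectories hN hx ht,
      (eq_stateOf_of_mem_trajectories hN hx ht).symm⟩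
  · intro x hx
    refine (potential_along_trajectory hN hrs hx).1.congr fun t ht => ?_
    simp only [snd_eq_of_mem_trajectories hN hx ht]
  · intro x hx
    refine (potential_along_trajectory hN hrs hx).2.congr' ?_
    filter_upwards [eventually_ge_atTop 0] with t ht
    simp only [snd_eq_of_mem_trajectories hN hx ht]

theorem isGAS_linkRate (hN : N.Assumptions) {rs : Path → ℝ} (hrs : N.IsWardrop rs) :
    IsGAS ((fun x t => (x t).2) '' N.trajectories rs) (Prod.snd '' N.feasibleStates)
      {(N.linkRate rs, N.linkRate rs)} := by
  refine isGAS_of_lyapunov (V := fun s => N.potential s.1)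
    (m := N.potential (N.linkRate rs)) (N.isCompact_feasibleStates.image continuous_snd)
    ((continuous_potential hN).comp continuous_fst).continuousOn ?_
    (singleton_nonempty _) ?_ ?_ ?_ ?_ ?_ ?_
  · rintro _ rfl
    exact ⟨_, ⟨rs, hrs.1, rfl⟩, rfl⟩
  · intro s hs
    rw [hs]
  · rintro _ ⟨_, ⟨r, hr, rfl⟩, rfl⟩ hne
    by_contra! hle
    refine hne ?_
    -- An allocation of minimal potential is Wardrop, and link rates are unique, so the potential
    -- separates the single point from all other feasible link rates.
    have h := (isWardrop_of_potential_le hN hrs hr hle).linkRate_eq hN hrs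
    simp [stateOf, h]
  · rintro _ ⟨s, hs, rfl⟩
    obtain ⟨x, hx, rfl⟩ := exists_trajectory hN rs hs
    exact ⟨_, ⟨x, hx, rfl⟩, rfl⟩
  · rintro _ ⟨x, hx, rfl⟩ t ht
    exact ⟨_, ⟨_, isFeasible_of_mem_trajectories hN hx ht,
      (eq_stateOf_of_mem_trajectories hN hx ht).symm⟩, rfl⟩
  · rintro _ ⟨x, hx, rfl⟩
    refine (potential_along_trajectory hN hrs hx).1.congr fun t ht => ?_
    simp only [snd_eq_of_mem_trajectories hN hx ht]
  · rintro _ ⟨x, hx, rfl⟩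
    refine (potential_along_trajectory hN hrs hx).2.congr' ?_
    filter_upwards [eventually_ge_atTop 0] with t ht
    simp only [snd_eq_of_mem_trajectories hN hx ht]

theorem equilibria_eq_singleton (hN : N.Assumptions) {rs : Path → ℝ} (hrs : N.IsWardrop rs)
    (h : N.LinkRatesDeterminePathRates) : N.equilibria rs = {N.stateOf rs} := by
  have hset : {r | N.IsWardrop r} = {rs} := by
    refine Set.eq_singleton_iff_unique_mem.2 ⟨hrs, fun r hr => ?_⟩
    refine sub_eq_zero.1 (h (r - rs) (hrs.1.sum_sub_eq_zero hr.1) ?_)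
    rw [← linkRateCLM_apply, map_sub, linkRateCLM_apply, linkRateCLM_apply,
      IsWardrop.linkRate_eq hN hr hrs, sub_self]
  rw [equilibria_eq hN, hset, image_singleton]

end OutOfBandNetwork

end

theorem mainTheorem3 {Source Path Link : Type*} [Fintype Path] [Fintype Link]
    (N : OutOfBandNetwork Source Path Link) (hN : N.Assumptions) :
    (∃ rs, N.IsWardrop rs) ∧
    ∀ rs, N.IsWardrop rs →
      N.equilibria rs = N.stateOf '' {r | N.IsWardrop r} ∧
      (∀ r, N.IsWardrop r → N.linkRate r = N.linkRate rs) ∧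
      IsGAS (N.trajectories rs) N.feasibleStates (N.equilibria rs) ∧
      IsGAS ((fun x t => (x t).2) '' N.trajectories rs) (Prod.snd '' N.feasibleStates)
        {(N.linkRate rs, N.linkRate rs)} ∧
      (N.LinkRatesDeterminePathRates →
        N.equilibria rs = {N.stateOf rs} ∧
        IsGAS (N.trajectories rs) N.feasibleStates {N.stateOf rs}) := by
  refine ⟨OutOfBandNetwork.exists_isWardrop hN, fun rs hrs =>
    ⟨OutOfBandNetwork.equilibria_eq hN rs, fun r hr => hr.linkRate_eq hN hrs,
      OutOfBandNetwork.isGAS_equilibria hN hrs, OutOfBandNetwork.isGAS_linkRate hN hrs,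
      fun h => ?_⟩⟩
  have hE := OutOfBandNetwork.equilibria_eq_singleton hN hrs h
  exact ⟨hE, hE ▸ OutOfBandNetwork.isGAS_equilibria hN hrs⟩
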